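/- **Setting.** Let $M_\bullet$ be a simplicial manifold whose terms are finite-dimensional complex manifolds and whose structure maps are smooth. Let $A_{DR}(M_p)$ be the algebra of smooth complex-valued differential forms on $M_p$. Let $\operatorname{Tot}_N(A_{DR}(M_\bullet))$ be the normalised total complex: in degree $k$ it consists of families of $q$-forms $a^{p,q}$ on $M_p$, $p+q=k$, annihilated by the pullbacks along all degeneracy maps. It carries the unital $C_\infty$-structure $m_\bullet$ with $m_1=D$, $D a=\tilde\partial a+(-1)^p da$ on elements of bidegree $(p,q)$ ($\tilde\partial$ is the alternating sum of the pullbacks along the face maps), and with $m_n$, $n\ge 2$, obtained by homotopy transfer from the polynomial (Thom--Whitney) model along Dupont's contraction of the forms on the simplices onto the Whitney forms. Let $B\subseteq \operatorname{Tot}_N(A_{DR}(M_\bullet))$ be a unital $C_\infty$-subalgebra. Let $W=\mathbb C\oplus W^1\oplus W^2$ be a finite-dimensional unital minimal $1$-$C_\infty$-algebra. It is given by multilinear maps $\delta_n$, $n\ge 2$, sending $n$ elements of $W^1$ to $W^2$, that vanish on non-trivial shuffles and whose values span $W^2$. Let $\widehat{\mathbb L}=\widehat{\mathbb L}((W^1[1])^*)$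 be the complete free Lie algebra (the primitive elements of the complete tensor algebra $\widehat T((W^1[1])^*)$), let $\mathcal R_0\subset\widehat{\mathbb L}$ be the closed Lie ideal generated by the image of the dual map $\delta^*:(W^2)^*\to\widehat{\mathbb L}$, and let $\mathfrak u'=\widehat{\mathbb L}/\mathcal R_0$. For a complex vector space $A$ let $A\widehat\otimes\mathfrak u'$ be the space of linear maps from the tensor coalgebra on $W^1[1]$ to $A$ that vanish on the empty word and on non-trivial shuffles, modulo those all of whose compositions with linear functionals on $A$ lie in $\mathcal R_0$. The degree-zero reduced convolution $L_\infty$-algebra with coefficients in $B$ is $B\widehat\otimes\mathfrak u'$. Its brackets $l_k$ are the antisymmetrisations of $$M_k(f_1,\dots,f_k)(w)=\sum_{w=w_1\cdots w_k}(-1)^k\,m_k\bigl(f_1(w_1),\dots,f_k(w_k)\bigr).$$ Let $\overline C\in B^1\widehat\otimes\mathfrak u'$ be a degree-zero geometric connection, i.e. a Maurer--Cartan element: $\sum_{k\ge1}\frac1{k!}l_k(\overline C,\dots,\overline C)=0$. Let $r$ be the projection onto the components of bidegree $(0,q)$ and set $\alpha=r_*\overline C\in A^1_{DR}(M_0)\widehat\otimes\mathfrak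 u'$. **Theorem.** 1. $\mathfrak u'$ is pronilpotent: with $I^0=\mathfrak u'$ and $I^{i}=[I^{i-1},\mathfrak u']$, every $\mathfrak u'/I^i$ is finite-dimensional and $\mathfrak u'\to\varprojlim_i\mathfrak u'/I^i$ is bijective. 2. Let $\nabla=d-\alpha$, acting on $\mathfrak u'$-valued forms on $M_0$ through the adjoint action: $\nabla s=ds-[\alpha,s]$ for $s\in A^k_{DR}(M_0)\widehat\otimes\mathfrak u'$. Then $\nabla$ is a flat connection on the trivial bundle over $M_0$ with fibre $\mathfrak u'$. That is, $\nabla$ is linear, $\nabla(fs)=df\cdot s+f\,\nabla s$ for every smooth function $f$ and every $s\in A^0_{DR}(M_0)\widehat\otimes\mathfrak u'$, and $\nabla\circ\nabla=0$ on forms of every degree. Moreover $d\alpha=\tfrac12[\alpha,\alpha]$ in $A^2_{DR}(M_0)\widehat\otimes\mathfrak u'$. 3. If $\overline C$ is holomorphic (it has a representative all of whose values have only holomorphic forms as components), then the connection form $\alpha$ is holomorphic (it has a representative with holomorphic coefficients). 4. Suppose $M_\bullet=N_\bullet\setminus\mathcal D_\bullet$, where $N_\bullet$ is a simplicial object of complex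 manifolds and holomorphic maps and $\mathcal D_\bullet$ is a simplicial normal crossing divisor in it. If $\overline C$ is holomorphic with logarithmic singularities along $\mathcal D_\bullet$, then $\alpha$ is holomorphic with logarithmic singularities along $\mathcal D_0$. -/

import Mathlib

universe u

noncomputable section

namespace GeomConn

open scoped Manifold ContDiff Topology
open Set

/-! ### Alternating forms and their wedge product -/

/-- Complex valued alternating `q`-forms on a real normed space. -/
abbrev Alt (V : Type*) [NormedAddCommGroup V] [NormedSpace ℝ V] (q : ℕ) :=
  V [⋀^Fin q]→L[ℝ] ℂ

section Wedge

variable {V W : Type*} [NormedAddCommGroup V] [NormedSpace ℝ V]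
  [NormedAddCommGroup W] [NormedSpace ℝ W]

/-- Antisymmetrisation `f ↦ ∑ σ, sign σ • f ∘ σ` as a continuous linear map. -/
def altCLM (V : Type*) [NormedAddCommGroup V] [NormedSpace ℝ V] (q : ℕ) :
    ContinuousMultilinearMap ℝ (fun _ : Fin q => V) ℂ →L[ℝ] Alt V q :=
  LinearMap.mkContinuous
    { toFun := fun f => ContinuousMultilinearMap.alternatization f
      map_add' := fun f g => map_add _ f g
      map_smul' := fun c f => by
        ext v
        simp [ContinuousMultilinearMap.alternatization_apply_apply, Finset.smul_sum,
          smul_comm c] }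
    (Fintype.card (Equiv.Perm (Fin q))) (fun f => by
      refine ContinuousAlternatingMap.opNorm_le_bound _ (by positivity) (fun v => ?_)
      simp only [LinearMap.coe_mk, AddHom.coe_mk,
        ContinuousMultilinearMap.alternatization_apply_apply]
      refine (norm_sum_le _ _).trans ?_
      have : ∀ σ ∈ (Finset.univ : Finset (Equiv.Perm (Fin q))),
          ‖Equiv.Perm.sign σ • f (v ∘ σ)‖ ≤ ‖f‖ * ∏ i, ‖v i‖ := by
        intro σ _
        have h1 : ‖Equiv.Perm.sign σ • f (v ∘ σ)‖ = ‖f (v ∘ σ)‖ := by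
          rcases Int.units_eq_one_or (Equiv.Perm.sign σ) with h | h <;> simp [h]
        rw [h1]
        refine (f.le_opNorm _).trans (le_of_eq ?_)
        congr 1
        exact Equiv.prod_comp σ (fun i => ‖v i‖)
      refine (Finset.sum_le_sum this).trans (le_of_eq ?_)
      simp [mul_assoc])

/-- The product `(v₁, …, v_{i+j}) ↦ a (v₁, …, v_i) * b (v_{i+1}, …, v_{i+j})`. -/
def prodMul {i j q : ℕ} (h : i + j = q) (a : Alt V i) (b : Alt V j) :
    ContinuousMultilinearMap ℝ (fun _ : Fin q => V) ℂ :=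
  { (LinearMap.mul' ℝ ℂ).compMultilinearMap
      ((a.toMultilinearMap.domCoprod b.toMultilinearMap).domDomCongr
        (finSumFinEquiv.trans (finCongr h))) with
    cont := by
      have : (fun v : Fin q → V => a (fun k => v (Fin.cast h (Fin.castAdd j k))) *
          b (fun k => v (Fin.cast h (Fin.natAdd i k)))) = _ := rfl
      change Continuous (fun v : Fin q → V => a (fun k => v (Fin.cast h (Fin.castAdd j k))) *
          b (fun k => v (Fin.cast h (Fin.natAdd i k))))
      fun_prop }

theorem prodMul_apply {i j q : ℕ} (h : i + j = q) (a : Alt V i) (b : Alt V j) (v : Fin q → V) :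
    prodMul h a b v = a (fun k => v (Fin.cast h (Fin.castAdd j k))) *
      b (fun k => v (Fin.cast h (Fin.natAdd i k))) := rfl

/-- The product of alternating maps, as a continuous bilinear map. -/
def prodMulCLM (V : Type*) [NormedAddCommGroup V] [NormedSpace ℝ V] {i j q : ℕ} (h : i + j = q) :
    Alt V i →L[ℝ] Alt V j →L[ℝ] ContinuousMultilinearMap ℝ (fun _ : Fin q => V) ℂ :=
  LinearMap.mkContinuous₂
    (LinearMap.mk₂ ℝ (fun a b => prodMul h a b)
      (fun a a' b => by ext v; simp [prodMul_apply, add_mul])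
      (fun c a b => by ext v; simp [prodMul_apply, mul_assoc])
      (fun a b b' => by ext v; simp [prodMul_apply, mul_add])
      (fun c a b => by ext v; simp [prodMul_apply, mul_left_comm])) 1
    (fun a b => by
      refine ContinuousMultilinearMap.opNorm_le_bound (by positivity) (fun v => ?_)
      simp only [LinearMap.mk₂_apply, prodMul_apply, norm_mul, one_mul]
      calc _ ≤ (‖a‖ * ∏ k, ‖v (Fin.cast h (Fin.castAdd j k))‖) *
              (‖b‖ * ∏ k, ‖v (Fin.cast h (Fin.natAdd i k))‖) :=
            mul_le_mul (a.le_opNorm _) (b.le_opNorm _) (norm_nonneg _) (by positivity)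
        _ = _ := by
          subst h
          rw [Fin.prod_univ_add]
          simp only [Fin.cast_eq_self]
          ring)

/-- The wedge product of alternating forms,
`(a ∧ b)(v) = (1 / (i! j!)) ∑ σ, sign σ a(v_{σ 1}, …, v_{σ i}) b(v_{σ (i+1)}, …, v_{σ (i+j)})`,
as a continuous bilinear map. -/
def wedgeCLM (V : Type*) [NormedAddCommGroup V] [NormedSpace ℝ V] {i j q : ℕ} (h : i + j = q) :
    Alt V i →L[ℝ] Alt V j →L[ℝ] Alt V q :=
  ((i.factorial * j.factorial : ℝ)⁻¹) •
    ((ContinuousLinearMap.compL ℝ _ _ _ (altCLM V q)).comp (prodMulCLM V h))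

theorem wedgeCLM_apply {i j q : ℕ} (h : i + j = q) (a : Alt V i) (b : Alt V j) (v : Fin q → V) :
    wedgeCLM V h a b v = ((i.factorial * j.factorial : ℝ)⁻¹) •
      ∑ σ : Equiv.Perm (Fin q), Equiv.Perm.sign σ •
        (a (fun k => v (σ (Fin.cast h (Fin.castAdd j k)))) *
          b (fun k => v (σ (Fin.cast h (Fin.natAdd i k))))) := by
  have : wedgeCLM V h a b = ((i.factorial * j.factorial : ℝ)⁻¹) •
    ContinuousMultilinearMap.alternatization (prodMul h a b) := rfl
  rw [this]
  simp [ContinuousMultilinearMap.alternatization_apply_apply, prodMul_apply]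

theorem wedgeCLM_comp {i j q : ℕ} (h : i + j = q) (a : Alt V i) (b : Alt V j) (L : W →L[ℝ] V) :
    (wedgeCLM V h a b).compContinuousLinearMap L =
      wedgeCLM W h (a.compContinuousLinearMap L) (b.compContinuousLinearMap L) := by
  ext v
  simp only [ContinuousAlternatingMap.compContinuousLinearMap_apply, wedgeCLM_apply]
  rfl

theorem wedgeCLM_smul_left {i j q : ℕ} (h : i + j = q) (c : ℂ) (a : Alt V i) (b : Alt V j) :
    wedgeCLM V h (c • a) b = c • wedgeCLM V h a b := by
  ext v
  simp only [ContinuousAlternatingMap.smul_apply, wedgeCLM_apply, smul_eq_mul,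
    mul_assoc]
  rw [← smul_eq_mul c, smul_comm c]
  congr 1
  rw [Finset.smul_sum]
  refine Finset.sum_congr rfl fun σ _ => ?_
  rw [smul_comm c, smul_eq_mul]

theorem wedgeCLM_smul_right {i j q : ℕ} (h : i + j = q) (c : ℂ) (a : Alt V i) (b : Alt V j) :
    wedgeCLM V h a (c • b) = c • wedgeCLM V h a b := by
  ext v
  simp only [ContinuousAlternatingMap.smul_apply, wedgeCLM_apply, smul_eq_mul,
    mul_left_comm _ c]
  rw [← smul_eq_mul c, smul_comm c]
  congr 1
  rw [Finset.smul_sum]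
  refine Finset.sum_congr rfl fun σ _ => ?_
  rw [smul_comm c, smul_eq_mul]

/-- Inhomogeneous alternating forms, as families of homogeneous components. -/
abbrev GAlt (V : Type*) [NormedAddCommGroup V] [NormedSpace ℝ V] := ∀ q, Alt V q

/-- The wedge product of inhomogeneous alternating forms. -/
def GAlt.wedge (a b : GAlt V) : GAlt V := fun q =>
  ∑ i : Fin (q + 1), wedgeCLM V (Nat.add_sub_cancel' (Nat.lt_succ_iff.1 i.2)) (a i) (b (q - i))

/-- The unit `0`-form. -/
def GAlt.one : GAlt V :=
  Function.update 0 0 (ContinuousAlternatingMap.constOfIsEmpty ℝ V (Fin 0) 1)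

/-- A linear functional as an inhomogeneous form concentrated in degree `1`. -/
def GAlt.ofLinear (L : V →L[ℝ] ℂ) : GAlt V :=
  Function.update 0 1 (ContinuousAlternatingMap.ofSubsingleton ℝ V ℂ (0 : Fin 1) L)

/-- The ordered wedge product of a list of forms. -/
def GAlt.wedgeList (l : List (GAlt V)) : GAlt V := l.foldr GAlt.wedge GAlt.one

/-- Pullback of forms, jointly smooth in the form and the linear map. -/
theorem contDiff_pull (q : ℕ) : ContDiff ℝ ∞ (fun p : Alt V q × (W →L[ℝ] V) =>
    p.1.compContinuousLinearMap p.2) := by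
  have key : (fun p : Alt V q × (W →L[ℝ] V) => p.1.compContinuousLinearMap p.2) =
      fun p => ((q.factorial : ℝ)⁻¹) • altCLM W q
        ((ContinuousMultilinearMap.compContinuousLinearMapContinuousMultilinear ℝ
          (fun _ : Fin q => W) (fun _ : Fin q => V) ℂ (fun _ => p.2))
          (ContinuousAlternatingMap.toContinuousMultilinearMapCLM ℝ p.1)) := by
    funext p
    ext v
    have : altCLM W q ((ContinuousMultilinearMap.compContinuousLinearMapContinuousMultilinear ℝ
          (fun _ : Fin q => W) (fun _ : Fin q => V) ℂ (fun _ => p.2))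
          (ContinuousAlternatingMap.toContinuousMultilinearMapCLM ℝ p.1)) v =
        ∑ σ : Equiv.Perm (Fin q), Equiv.Perm.sign σ • p.1 (fun k => p.2 (v (σ k))) := by
      simp only [altCLM, LinearMap.mkContinuous_apply, LinearMap.coe_mk, AddHom.coe_mk,
        ContinuousMultilinearMap.alternatization_apply_apply]
      rfl
    rw [ContinuousAlternatingMap.smul_apply, this]
    have h2 : ∀ σ : Equiv.Perm (Fin q),
        Equiv.Perm.sign σ • p.1 (fun k => p.2 (v (σ k))) = p.1 (fun k => p.2 (v k)) := by
      intro σ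
      have := p.1.toAlternatingMap.map_perm (fun k => p.2 (v k)) σ
      simp only [Function.comp_def] at this
      change Equiv.Perm.sign σ • (p.1.toAlternatingMap fun k => p.2 (v (σ k))) = _
      rw [this, smul_smul]
      simp
    simp only [h2, Finset.sum_const, Finset.card_univ, Fintype.card_perm, Fintype.card_fin]
    simp only [ContinuousAlternatingMap.compContinuousLinearMap_apply, Function.comp_def]
    rw [nsmul_eq_mul, Complex.real_smul, ← mul_assoc]
    simp [Nat.factorial_ne_zero]
  rw [key]
  refine ContDiff.const_smul _ (ContDiff.continuousLinearMap_comp (altCLM W q) ?_)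
  refine ContDiff.clm_apply ?_ ?_
  · exact (ContinuousMultilinearMap.contDiff _).comp (contDiff_pi.2 fun _ => contDiff_snd)
  · exact (ContinuousLinearMap.contDiff _).comp contDiff_fst

end Wedge

/-! ### Differential forms on manifolds -/

section Forms

variable {E : Type*} [NormedAddCommGroup E] [NormedSpace ℝ E]
  {M : Type*} [TopologicalSpace M] [ChartedSpace E M]
  {F : Type*} [NormedAddCommGroup F] [NormedSpace ℝ F]
  {N : Type*} [TopologicalSpace N] [ChartedSpace F N]

/-- The representative in the chart `e` of a complex valued `q`-form `θ` on `M`: the pullback of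
`θ` along `e.symm`. Pointwise forms are functions `M → Alt E q`, as the tangent space of `M` at
every point is by definition the model space `E`. -/
def rep (e : OpenPartialHomeomorph M E) {q : ℕ} (θ : M → Alt E q) (y : E) : Alt E q :=
  (θ (e.symm y)).compContinuousLinearMap
    (mfderiv 𝓘(ℝ, E) 𝓘(ℝ, E) e.symm y : E →L[ℝ] E)

/-- Smooth forms: smooth in all charts of the smooth structure. -/
def IsSmoothForm {q : ℕ} (θ : M → Alt E q) : Prop :=
  ∀ e ∈ IsManifold.maximalAtlas 𝓘(ℝ, E) ∞ M, ContDiffOn ℝ ∞ (rep e θ) e.target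

/-- Pullback of pointwise forms. -/
def pullPt (f : M → N) {q : ℕ} (θ : N → Alt F q) (x : M) : Alt E q :=
  (θ (f x)).compContinuousLinearMap (mfderiv 𝓘(ℝ, E) 𝓘(ℝ, F) f x : E →L[ℝ] F)

/-- The exterior derivative of a form: the exterior derivative of its representative in the
preferred chart at the point. -/
def dPt {q : ℕ} (θ : M → Alt E q) (x : M) : Alt E (q + 1) :=
  (extDeriv (rep (chartAt E x) θ) (chartAt E x x)).compContinuousLinearMap
    (mfderiv 𝓘(ℝ, E) 𝓘(ℝ, E) (chartAt E x) x : E →L[ℝ] E)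

section Lemmas

theorem IsSmoothForm.wedge {i j q : ℕ} (h : i + j = q) {θ : M → Alt E i} {η : M → Alt E j}
    (hθ : IsSmoothForm θ) (hη : IsSmoothForm η) :
    IsSmoothForm (fun x => wedgeCLM E h (θ x) (η x)) := by
  intro e he
  have : rep e (fun x => wedgeCLM E h (θ x) (η x)) =
      fun y => wedgeCLM E h (rep e θ y) (rep e η y) := by
    funext y
    exact wedgeCLM_comp h _ _ _
  rw [this]
  exact ((wedgeCLM E h).contDiff.comp_contDiffOn (hθ e he)).clm_apply (hη e he)

theorem contMDiffAt_chart {e : OpenPartialHomeomorph M E}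
    (he : e ∈ IsManifold.maximalAtlas 𝓘(ℝ, E) ∞ M) {x : M} (hx : x ∈ e.source) :
    ContMDiffAt 𝓘(ℝ, E) 𝓘(ℝ, E) ∞ e x :=
  (contMDiffOn_of_mem_maximalAtlas he).contMDiffAt (e.open_source.mem_nhds hx)

theorem contMDiffAt_chart_symm {e : OpenPartialHomeomorph M E}
    (he : e ∈ IsManifold.maximalAtlas 𝓘(ℝ, E) ∞ M) {y : E} (hy : y ∈ e.target) :
    ContMDiffAt 𝓘(ℝ, E) 𝓘(ℝ, E) ∞ e.symm y :=
  (contMDiffOn_symm_of_mem_maximalAtlas he).contMDiffAt (e.open_target.mem_nhds hy)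

theorem contDiffAt_transition {f : M → N} (hf : ContMDiff 𝓘(ℝ, E) 𝓘(ℝ, F) ∞ f)
    {e : OpenPartialHomeomorph M E} (he : e ∈ IsManifold.maximalAtlas 𝓘(ℝ, E) ∞ M)
    {e' : OpenPartialHomeomorph N F} (he' : e' ∈ IsManifold.maximalAtlas 𝓘(ℝ, F) ∞ N)
    {y : E} (hy : y ∈ e.target) (hy' : f (e.symm y) ∈ e'.source) :
    ContDiffAt ℝ ∞ (e' ∘ f ∘ e.symm) y := by
  rw [← contMDiffAt_iff_contDiffAt]
  exact (contMDiffAt_chart he' hy').comp y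
    ((hf.contMDiffAt (x := e.symm y)).comp y (contMDiffAt_chart_symm he hy))

theorem rep_pullPt {f : M → N} (hf : ContMDiff 𝓘(ℝ, E) 𝓘(ℝ, F) ∞ f)
    {e : OpenPartialHomeomorph M E} (he : e ∈ IsManifold.maximalAtlas 𝓘(ℝ, E) ∞ M)
    {e' : OpenPartialHomeomorph N F} (he' : e' ∈ IsManifold.maximalAtlas 𝓘(ℝ, F) ∞ N)
    {y : E} (hy : y ∈ e.target) (hy' : f (e.symm y) ∈ e'.source) {q : ℕ} (θ : N → Alt F q) :
    rep e (pullPt f θ) y =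
      (rep e' θ ((e' ∘ f ∘ e.symm) y)).compContinuousLinearMap
        (fderiv ℝ (e' ∘ f ∘ e.symm) y) := by
  have h1 : e'.symm ((e' ∘ f ∘ e.symm) y) = f (e.symm y) := e'.left_inv hy'
  have hF : MDifferentiableAt 𝓘(ℝ, E) 𝓘(ℝ, F) (e' ∘ f ∘ e.symm) y :=
    ((contDiffAt_transition hf he he' hy hy').differentiableAt (by simp)).mdifferentiableAt
  have hy2 : (e' ∘ f ∘ e.symm) y ∈ e'.target := e'.map_source hy'
  have h2 : (mfderiv 𝓘(ℝ, F) 𝓘(ℝ, F) e'.symm ((e' ∘ f ∘ e.symm) y)).comp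
      (mfderiv 𝓘(ℝ, E) 𝓘(ℝ, F) (e' ∘ f ∘ e.symm) y) =
      (mfderiv 𝓘(ℝ, E) 𝓘(ℝ, F) f (e.symm y)).comp (mfderiv 𝓘(ℝ, E) 𝓘(ℝ, E) e.symm y) := by
    rw [← mfderiv_comp y ((contMDiffAt_chart_symm he' hy2).mdifferentiableAt (by simp)) hF,
      ← mfderiv_comp y ((hf.contMDiffAt).mdifferentiableAt (by simp))
        ((contMDiffAt_chart_symm he hy).mdifferentiableAt (by simp))]
    apply Filter.EventuallyEq.mfderiv_eq
    have hc : ContinuousAt (f ∘ e.symm) y :=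
      hf.continuous.continuousAt.comp (e.continuousAt_symm hy)
    filter_upwards [hc.preimage_mem_nhds (e'.open_source.mem_nhds hy')] with z hz
    exact e'.left_inv hz
  rw [mfderiv_eq_fderiv] at h2
  have h3 := congrArg (fun L : E →L[ℝ] F => (θ (f (e.symm y))).compContinuousLinearMap L) h2
  refine Eq.trans (h3.symm : _) ?_
  rw [← h1]
  rfl

theorem pullPt_id {q : ℕ} (θ : M → Alt E q) : pullPt (id : M → M) θ = θ := by
  funext x
  ext v
  simp only [pullPt, mfderiv_id]
  rfl

theorem rep_transition {e e' : OpenPartialHomeomorph M E}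
    (he : e ∈ IsManifold.maximalAtlas 𝓘(ℝ, E) ∞ M)
    (he' : e' ∈ IsManifold.maximalAtlas 𝓘(ℝ, E) ∞ M)
    {y : E} (hy : y ∈ e.target) (hy' : e.symm y ∈ e'.source) {q : ℕ} (θ : M → Alt E q) :
    rep e θ y = (rep e' θ ((e' ∘ e.symm) y)).compContinuousLinearMap
        (fderiv ℝ (e' ∘ e.symm) y) := by
  have := rep_pullPt (f := (id : M → M)) contMDiff_id he he' hy hy' θ
  rwa [pullPt_id] at this

variable [IsManifold 𝓘(ℝ, F) ∞ N]

theorem IsSmoothForm.pullPt {f : M → N} (hf : ContMDiff 𝓘(ℝ, E) 𝓘(ℝ, F) ∞ f) {q : ℕ}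
    {θ : N → Alt F q} (hθ : IsSmoothForm θ) :
    IsSmoothForm (pullPt (E := E) f θ) := by
  intro e he y hy
  set z := f (e.symm y) with hz
  have hc := IsManifold.chart_mem_maximalAtlas (I := 𝓘(ℝ, F)) (n := ∞) z
  have hzc := mem_chart_source F z
  set c := chartAt F z with hcdef
  have hF := contDiffAt_transition hf he hc hy hzc
  have h1 : ContDiffAt ℝ ∞ (fun w => (rep c θ ((c ∘ f ∘ e.symm) w)).compContinuousLinearMap
      (fderiv ℝ (c ∘ f ∘ e.symm) w)) y := by
    have ha : ContDiffAt ℝ ∞ (rep c θ) ((c ∘ f ∘ e.symm) y) :=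
      (hθ c hc).contDiffAt (c.open_target.mem_nhds (c.map_source hzc))
    exact (contDiff_pull (V := F) (W := E) q).contDiffAt.comp y
      ((ha.comp y hF).prodMk (hF.fderiv_right (by simp)))
  refine (h1.congr_of_eventuallyEq ?_).contDiffWithinAt
  have hcont : ContinuousAt (f ∘ e.symm) y :=
    hf.continuous.continuousAt.comp (e.continuousAt_symm hy)
  filter_upwards [e.open_target.mem_nhds hy,
    hcont.preimage_mem_nhds (c.open_source.mem_nhds hzc)] with w hw hw'
  exact rep_pullPt hf he hc hw hw' θ

variable [IsManifold 𝓘(ℝ, E) ∞ M]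

/-- The exterior derivative is computed in any chart. -/
theorem rep_dPt {e : OpenPartialHomeomorph M E}
    (he : e ∈ IsManifold.maximalAtlas 𝓘(ℝ, E) ∞ M) {q : ℕ} {θ : M → Alt E q}
    (hθ : IsSmoothForm θ) {y : E} (hy : y ∈ e.target) :
    rep e (dPt θ) y = extDeriv (rep e θ) y := by
  set x := e.symm y with hx
  have hc := IsManifold.chart_mem_maximalAtlas (I := 𝓘(ℝ, E)) (n := ∞) x
  have hxc := mem_chart_source E x
  set c := chartAt E x with hcdef
  have hev : rep e θ =ᶠ[𝓝 y] fun z => (rep c θ ((c ∘ e.symm) z)).compContinuousLinearMap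
      (fderiv ℝ (c ∘ e.symm) z) := by
    filter_upwards [e.open_target.mem_nhds hy,
      (e.continuousAt_symm hy).preimage_mem_nhds (c.open_source.mem_nhds hxc)] with z hz hz'
    exact rep_transition he hc hz hz' θ
  have hg : ContDiffAt ℝ ∞ (c ∘ e.symm) y :=
    contDiffAt_transition (f := (id : M → M)) contMDiff_id he hc hy hxc
  have hdiff : DifferentiableAt ℝ (rep c θ) ((c ∘ e.symm) y) :=
    ((hθ c hc).contDiffAt (c.open_target.mem_nhds (c.map_source hxc))).differentiableAt (by simp)
  rw [hev.extDeriv_eq, extDeriv_pullback hdiff hg (by simpa using (by exact_mod_cast le_top : ((2 : ℕ∞) : WithTop ℕ∞) ≤ ∞))]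
  have h2 : (mfderiv 𝓘(ℝ, E) 𝓘(ℝ, E) c x).comp (mfderiv 𝓘(ℝ, E) 𝓘(ℝ, E) e.symm y) =
      mfderiv 𝓘(ℝ, E) 𝓘(ℝ, E) (c ∘ e.symm) y :=
    (mfderiv_comp y ((contMDiffAt_chart hc hxc).mdifferentiableAt (by simp))
      ((contMDiffAt_chart_symm he hy).mdifferentiableAt (by simp))).symm
  rw [mfderiv_eq_fderiv] at h2
  exact congrArg (fun L : E →L[ℝ] E =>
    (extDeriv (rep c θ) (c x)).compContinuousLinearMap L) h2

theorem IsSmoothForm.dPt {q : ℕ} {θ : M → Alt E q} (hθ : IsSmoothForm θ) :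
    IsSmoothForm (dPt θ) := by
  intro e he
  have h1 : ContDiffOn ℝ ∞ (extDeriv (rep e θ)) e.target := by
    have : ContDiffOn ℝ ∞ (fderiv ℝ (rep e θ)) e.target :=
      (hθ e he).fderiv_of_isOpen e.open_target (by simp)
    exact (ContinuousAlternatingMap.alternatizeUncurryFinCLM ℝ E ℂ).contDiff.comp_contDiffOn this
  exact h1.congr fun y hy => rep_dPt he hθ hy

end Lemmas

end Forms

/-! ### Complex manifolds and simplicial manifolds -/

/-- A finite dimensional complex manifold. -/
structure ComplexManifold where
  Model : Type
  carrier : Type u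
  [normed : NormedAddCommGroup Model]
  [space : NormedSpace ℂ Model]
  [finDim : FiniteDimensional ℂ Model]
  [top : TopologicalSpace carrier]
  [charted : ChartedSpace Model carrier]
  [manifold : IsManifold 𝓘(ℂ, Model) ω carrier]

attribute [instance] ComplexManifold.normed ComplexManifold.space ComplexManifold.finDim
  ComplexManifold.top ComplexManifold.charted ComplexManifold.manifold

instance : CoeSort ComplexManifold.{u} (Type u) := ⟨ComplexManifold.carrier⟩

/-- The underlying smooth manifold of a complex manifold. -/
instance (X : ComplexManifold.{u}) : IsManifold 𝓘(ℝ, X.Model) ∞ X := by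
  refine isManifold_of_contDiffOn _ _ _ fun e e' he he' => ?_
  have h := (contDiffGroupoid ω 𝓘(ℂ, X.Model)).compatible he he'
  rw [contDiffGroupoid, mem_groupoid_of_pregroupoid] at h
  have h1 : ContDiffOn ℂ ω (𝓘(ℂ, X.Model) ∘ (e.symm.trans e') ∘ 𝓘(ℂ, X.Model).symm)
    (𝓘(ℂ, X.Model).symm ⁻¹' (e.symm.trans e').source ∩ range 𝓘(ℂ, X.Model)) := h.1
  have h2 := (h1.of_le (m := ∞) le_top).restrict_scalars ℝ
  simpa using h2

/-- The subspace of smooth complex valued `q`-forms on `X`. -/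
def smoothForms (X : ComplexManifold.{u}) (q : ℕ) : Submodule ℂ (X → Alt X.Model q) where
  carrier := {θ | IsSmoothForm θ}
  zero_mem' := fun e _ => by
    have : rep e (0 : X → Alt X.Model q) = fun _ => 0 := by
      funext y
      rfl
    rw [this]
    exact contDiffOn_const
  add_mem' := fun {θ η} hθ hη e he => (hθ e he).add (hη e he)
  smul_mem' := fun c θ hθ e he =>
    ((ContinuousLinearMap.lsmul ℝ ℂ (E := Alt X.Model q) c).contDiff.comp_contDiffOn (hθ e he) :)

/-- The complex vector space of smooth complex valued `q`-forms on `X`. -/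
def Form (X : ComplexManifold.{u}) (q : ℕ) : Type u := smoothForms X q

instance (X : ComplexManifold.{u}) (q : ℕ) : AddCommGroup (Form X q) :=
  inferInstanceAs (AddCommGroup (smoothForms X q))

instance (X : ComplexManifold.{u}) (q : ℕ) : Module ℂ (Form X q) :=
  inferInstanceAs (Module ℂ (smoothForms X q))

namespace Form

variable {X Y : ComplexManifold.{u}}

theorem differentiableAt_rep {q : ℕ} (θ : Form X q) (x : X) :
    DifferentiableAt ℝ (rep (chartAt X.Model x) θ.1) (chartAt X.Model x x) :=
  ((θ.2 _ (IsManifold.chart_mem_maximalAtlas (I := 𝓘(ℝ, X.Model)) (n := ∞) x)).contDiffAt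
    ((chartAt X.Model x).open_target.mem_nhds (mem_chart_target _ x))).differentiableAt (by simp)

/-- The exterior derivative. -/
def d {q : ℕ} : Form X q →ₗ[ℂ] Form X (q + 1) where
  toFun θ := ⟨dPt θ.1, IsSmoothForm.dPt θ.2⟩
  map_add' θ η := by
    apply Subtype.ext
    funext x
    have h := extDeriv_add (differentiableAt_rep θ x) (differentiableAt_rep η x)
    exact congrArg (fun a : Alt X.Model (q + 1) => a.compContinuousLinearMap
      (mfderiv 𝓘(ℝ, X.Model) 𝓘(ℝ, X.Model) (chartAt X.Model x) x : X.Model →L[ℝ] X.Model)) h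
  map_smul' c θ := by
    apply Subtype.ext
    funext x
    have h : extDeriv (c • rep (chartAt X.Model x) θ.1) (chartAt X.Model x x) =
        c • extDeriv (rep (chartAt X.Model x) θ.1) (chartAt X.Model x x) := by
      ext v
      rw [ContinuousAlternatingMap.smul_apply, extDeriv_apply (differentiableAt_rep θ x),
        extDeriv_apply ((differentiableAt_rep θ x).const_smul c), Finset.smul_sum]
      refine Finset.sum_congr rfl fun i _ => ?_
      rw [smul_comm c]
      congr 1
      have hd := (differentiableAt_rep θ x).continuousAlternatingMap_apply
        (fun k => differentiableAt_const (i.removeNth v k))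
      exact DFunLike.congr_fun (fderiv_const_smul hd c) (v i)
    exact congrArg (fun a : Alt X.Model (q + 1) => a.compContinuousLinearMap
      (mfderiv 𝓘(ℝ, X.Model) 𝓘(ℝ, X.Model) (chartAt X.Model x) x : X.Model →L[ℝ] X.Model)) h

/-- The wedge product. -/
def wedge {i j q : ℕ} (h : i + j = q) : Form X i →ₗ[ℂ] Form X j →ₗ[ℂ] Form X q :=
  LinearMap.mk₂ ℂ
    (fun θ η => ⟨fun x => wedgeCLM X.Model h (θ.1 x) (η.1 x), IsSmoothForm.wedge h θ.2 η.2⟩)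
    (fun θ θ' η => Subtype.ext (funext fun x => by
      change wedgeCLM X.Model h (θ.1 x + θ'.1 x) (η.1 x) =
        wedgeCLM X.Model h (θ.1 x) (η.1 x) + wedgeCLM X.Model h (θ'.1 x) (η.1 x)
      rw [map_add, add_apply]))
    (fun c θ η => Subtype.ext (funext fun x => wedgeCLM_smul_left h c (θ.1 x) (η.1 x)))
    (fun θ η η' => Subtype.ext (funext fun x => map_add (wedgeCLM X.Model h (θ.1 x)) _ _))
    (fun c θ η => Subtype.ext (funext fun x => wedgeCLM_smul_right h c (θ.1 x) (η.1 x)))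

/-- The pullback along a smooth map. -/
def pull (f : X → Y) (hf : ContMDiff 𝓘(ℝ, X.Model) 𝓘(ℝ, Y.Model) ∞ f) {q : ℕ} :
    Form Y q →ₗ[ℂ] Form X q where
  toFun θ := ⟨pullPt f θ.1, IsSmoothForm.pullPt hf θ.2⟩
  map_add' _ _ := rfl
  map_smul' _ _ := rfl

/-- The constant function `1`. -/
def one (X : ComplexManifold.{u}) : Form X 0 :=
  ⟨fun _ => ContinuousAlternatingMap.constOfIsEmpty ℝ X.Model (Fin 0) 1, fun _ _ =>
    (contDiffOn_const (c := ContinuousAlternatingMap.constOfIsEmpty ℝ X.Model (Fin 0) (1 : ℂ))).congr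
      fun _ _ => rfl⟩

end Form

/-- Inhomogeneous smooth forms, as families of homogeneous components. -/
abbrev GForm (X : ComplexManifold.{u}) := ∀ q, Form X q

namespace GForm

variable {X Y : ComplexManifold.{u}}

/-- The wedge product of inhomogeneous forms. -/
def wedge (a b : GForm X) : GForm X := fun q =>
  ∑ i : Fin (q + 1), Form.wedge (Nat.add_sub_cancel' (Nat.lt_succ_iff.1 i.2)) (a i) (b (q - i))

/-- The unit form. -/
def one (X : ComplexManifold.{u}) : GForm X := Function.update 0 0 (Form.one X)

/-- The ordered wedge product of a list of forms. -/
def wedgeList (l : List (GForm X)) : GForm X := l.foldr wedge (one X)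

/-- Multiplication of the component of degree `q` by `(-1) ^ (n * q)`. -/
def twist (n : ℕ) (a : GForm X) : GForm X := fun q => (-1 : ℂ) ^ (n * q) • a q

/-- The pullback along a smooth map. -/
def pull (f : X → Y) (hf : ContMDiff 𝓘(ℝ, X.Model) 𝓘(ℝ, Y.Model) ∞ f) (a : GForm Y) : GForm X :=
  fun q => Form.pull f hf (a q)

end GForm

/-- A simplicial manifold: a contravariant functor from the simplex category to complex manifolds
and smooth maps. -/
structure SimplicialManifold where
  obj : ℕ → ComplexManifold.{u}
  map : ∀ {m n : ℕ}, (Fin (m + 1) →o Fin (n + 1)) → obj n → obj m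
  map_id : ∀ n, map (OrderHom.id : Fin (n + 1) →o Fin (n + 1)) = id
  map_comp : ∀ {l m n : ℕ} (f : Fin (l + 1) →o Fin (m + 1)) (g : Fin (m + 1) →o Fin (n + 1)),
    map (g.comp f) = map f ∘ map g
  smooth : ∀ {m n : ℕ} (f : Fin (m + 1) →o Fin (n + 1)),
    ContMDiff 𝓘(ℝ, (obj n).Model) 𝓘(ℝ, (obj m).Model) ∞ (map f)

/-! ### Whitney forms, Dupont's contraction and the structure constants on simplices

Forms on the simplex `Δ^l` are written in the coordinates `t₁, …, t_l`, with
`t₀ = 1 - t₁ - ⋯ - t_l`. -/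

namespace Simplex

variable {l : ℕ}

/-- Inhomogeneous complex valued forms on `ℝ^l`. -/
abbrev SForm (l : ℕ) := (Fin l → ℝ) → GAlt (Fin l → ℝ)

/-- The wedge product of inhomogeneous forms. -/
def wedge (a b : SForm l) : SForm l := fun x => (a x).wedge (b x)

/-- The barycentric coordinate `t_j`. -/
def bary (j : Fin (l + 1)) (x : Fin l → ℝ) : ℝ := Fin.cases (1 - ∑ i, x i) x j

/-- The vertex `e_j`. -/
def vertex (j : Fin (l + 1)) : Fin l → ℝ := Fin.cases 0 (fun i => Pi.single i 1) j

/-- The `1`-form `dt_j`. -/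
def dbary (j : Fin (l + 1)) : SForm l := fun x =>
  GAlt.ofLinear (Complex.ofRealCLM.comp (fderiv ℝ (bary j) x))

/-- The Whitney form `p! ∑ₖ (-1)ᵏ t_{iₖ} dt_{i₀} ∧ ⋯ ∧ \hat{dt_{iₖ}} ∧ ⋯ ∧ dt_{iₚ}` of the face
with vertices `i₀ < ⋯ < iₚ`. -/
def whitney (I : Finset (Fin (l + 1))) : SForm l := fun x =>
  ((I.card - 1).factorial : ℂ) • ∑ k : Fin (I.sort (· ≤ ·)).length,
    ((-1 : ℂ) ^ (k : ℕ) * (bary ((I.sort (· ≤ ·)).get k) x : ℂ)) •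
      GAlt.wedgeList (((I.sort (· ≤ ·)).eraseIdx k).map fun j => dbary j x)

/-- Integration along the fibre of the dilation `(u, x) ↦ u x + (1 - u) e_i`, `0 ≤ u ≤ 1`. -/
def cone (i : Fin (l + 1)) (a : SForm l) : SForm l := fun x q =>
  ∫ u in (0 : ℝ)..1, u ^ q • (a (u • x + (1 - u) • vertex i) (q + 1)).curryLeft (x - vertex i)

/-- Dupont's homotopy
`s a = ∑ (-1)^(k+1) ω_{i₀ … iₖ} ∧ cone iₖ (⋯ (cone i₁ (cone i₀ a)))`, the sum over all faces
`i₀ < ⋯ < iₖ`. It satisfies `d s + s d = E ∘ ∫ - id`, where `E ∘ ∫` is the projection onto the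
span of the Whitney forms given by the integrals over the faces. -/
def homotopy (a : SForm l) : SForm l := fun x =>
  ∑ I : {I : Finset (Fin (l + 1)) // I.Nonempty},
    (-1 : ℂ) ^ I.1.card • wedge (whitney I.1) ((I.1.sort (· ≤ ·)).foldl (fun b i => cone i b) a) x

/-- The total degree of the Whitney forms of a list of faces. -/
def faceDegree (L : List (Finset (Fin (l + 1)))) : ℕ := (L.map fun I => I.card - 1).sum

/-- The kernels of the homotopy transfer along Dupont's contraction, evaluated on the Whitney
forms of the faces `I₁, …, Iₙ`:
`pₙ = ∑_{i+j=n} ± qᵢ ∧ qⱼ` with `q₁ = id` and `qₖ = homotopy ∘ pₖ` for `k ≥ 2`, the sign being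
`(-1) ^ (i (j + 1) + (1 - j) (|I₁| + ⋯ + |Iᵢ|))`. The first argument bounds the number of
recursive calls; it has to be at least `n`. -/
def kernel : ℕ → List (Finset (Fin (l + 1))) → SForm l
  | 0, _ => 0
  | m + 1, L => ∑ i ∈ Finset.Ioo 0 L.length,
      (-1 : ℂ) ^ (i * (L.length - i + 1) + (L.length - i + 1) * faceDegree (L.take i)) •
        wedge
          (if i = 1 then whitney (L.headD ∅) else homotopy (kernel m (L.take i)))
          (if L.length - i = 1 then whitney (L.getLastD ∅) else homotopy (kernel m (L.drop i)))

/-- The standard `l`-simplex in the coordinates `t₁, …, t_l`. -/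
def coordSimplex (l : ℕ) : Set (Fin l → ℝ) := {x | (∀ i, 0 ≤ x i) ∧ ∑ i, x i ≤ 1}

/-- The structure constant: the coefficient of the top Whitney form of `Δ^l` in the transferred
`n`-ary product, `n ≥ 2`, of the Whitney forms of the faces `I₁, …, Iₙ`, that is the integral over
`Δ^l` of the transfer kernel. -/
def coeff (l : ℕ) (L : List (Finset (Fin (l + 1)))) : ℂ :=
  ∫ x in coordSimplex l, kernel L.length L x l (fun i => Pi.single i 1)

end Simplex

/-! ### The total complex of forms on a simplicial manifold and its products -/

/-- Families `(a p q)` of `q`-forms on `S_p`. -/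
def BiForm (S : SimplicialManifold.{u}) := ∀ p q : ℕ, Form (S.obj p) q

instance (S : SimplicialManifold.{u}) : AddCommGroup (BiForm S) :=
  inferInstanceAs (AddCommGroup (∀ p q : ℕ, Form (S.obj p) q))

instance (S : SimplicialManifold.{u}) : Module ℂ (BiForm S) :=
  inferInstanceAs (Module ℂ (∀ p q : ℕ, Form (S.obj p) q))

namespace BiForm

variable {S : SimplicialManifold.{u}}

/-- The pullback along a structure map. -/
def act {m n : ℕ} (f : Fin (m + 1) →o Fin (n + 1)) (a : GForm (S.obj m)) : GForm (S.obj n) :=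
  GForm.pull (S.map f) (S.smooth f) a

/-- The alternating sum of the pullbacks along the face maps. -/
def simplicialDiff (a : BiForm S) : BiForm S
  | 0, _ => 0
  | p + 1, q => ∑ k : Fin (p + 2), (-1 : ℂ) ^ (k : ℕ) •
      act (Fin.succAboveOrderEmb k).toOrderHom (a p) q

/-- The exterior derivative in each simplicial degree. -/
def deRhamDiff (a : BiForm S) : BiForm S
  | _, 0 => 0
  | p, q + 1 => Form.d (a p q)

/-- The differential `D a = ∂ a + (-1)^p d a` for `a` of bidegree `(p, q)`. -/
def totalDiff (a : BiForm S) : BiForm S := fun p q =>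
  simplicialDiff a p q + (-1 : ℂ) ^ p • deRhamDiff a p q

/-- The order preserving map `[|I| - 1] → [l]` with image `I`. -/
def face {l : ℕ} (I : {I : Finset (Fin (l + 1)) // I.Nonempty}) :
    Fin (I.1.card - 1 + 1) →o Fin (l + 1) :=
  (I.1.orderEmbOfFin (Nat.sub_add_cancel (Finset.card_pos.2 I.2)).symm).toOrderHom

/-- The transferred products for `n ≥ 2`. Writing an element `a` as the compatible family
`∑_I ω_I ⊗ σ_I^* a`, the sum over the faces `I` of `Δ^l`, this is the `n`-ary product transferred
along Dupont's contraction, with the Koszul sign `(-1) ^ ∑_{i<j} q_i p_j` on components of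
bidegrees `(p_i, q_i)`. -/
def product {n : ℕ} (a : Fin n → BiForm S) : BiForm S := fun l =>
  ∑ I ∈ (Finset.univ : Finset (Fin n → {I : Finset (Fin (l + 1)) // I.Nonempty})).filter
      (fun I => ∑ i, ((I i).1.card - 1) + 2 = l + n),
    Simplex.coeff l (List.ofFn fun i => (I i).1) •
      GForm.wedgeList (List.ofFn fun i =>
        GForm.twist (∑ j ∈ Finset.Ioi i, ((I j).1.card - 1))
          (act (face (I i)) (a i ((I i).1.card - 1))))

/-- The structure maps `m_n` of the `C_∞`-algebra of the simplicial manifold: `m_1 = D`, and the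
transferred products for `n ≥ 2`. -/
def m : ∀ n : ℕ, (Fin n → BiForm S) → BiForm S
  | 0, _ => 0
  | 1, a => totalDiff (a 0)
  | _ + 2, a => product a

/-- The unit: the constant function `1` on `S_0`. -/
def one (S : SimplicialManifold.{u}) : BiForm S := Function.update 0 0 (GForm.one (S.obj 0))

/-- The part of total degree `k` of the normalised total complex: families concentrated in
bidegrees `(p, q)` with `p + q = k` that are annihilated by the pullbacks along all degeneracy
maps. -/
def TotN (S : SimplicialManifold.{u}) (k : ℕ) : Submodule ℂ (BiForm S) where
  carrier := {a | (∀ p q, p + q ≠ k → a p q = 0) ∧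
    ∀ p (i : Fin (p + 1)), act ⟨Fin.predAbove i, Fin.predAbove_right_monotone i⟩ (a (p + 1)) = 0}
  zero_mem' := ⟨fun _ _ _ => rfl, fun p i => funext fun q => map_zero (Form.pull _ _)⟩
  add_mem' := fun {a b} ha hb => ⟨fun p q h => by
      change a p q + b p q = 0
      rw [ha.1 p q h, hb.1 p q h, add_zero], fun p i => funext fun q => by
      have h1 := congrFun (ha.2 p i) q
      have h2 := congrFun (hb.2 p i) q
      change Form.pull _ _ (a (p + 1) q) = 0 at h1
      change Form.pull _ _ (b (p + 1) q) = 0 at h2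
      change Form.pull _ _ (a (p + 1) q + b (p + 1) q) = 0
      rw [map_add, h1, h2, add_zero]⟩
  smul_mem' := fun c a ha => ⟨fun p q h => by
      change c • a p q = 0
      rw [ha.1 p q h, smul_zero], fun p i => funext fun q => by
      have h1 := congrFun (ha.2 p i) q
      change Form.pull _ _ (a (p + 1) q) = 0 at h1
      change Form.pull _ _ (c • a (p + 1) q) = 0
      rw [map_smul, h1, smul_zero]⟩

end BiForm

/-- A unital `C_∞`-subalgebra of the `C_∞`-algebra of a simplicial manifold. -/
structure CInfSubalgebra (S : SimplicialManifold.{u}) where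
  part : ℕ → Submodule ℂ (BiForm S)
  part_le : ∀ k, part k ≤ BiForm.TotN S k
  one_mem : BiForm.one S ∈ part 0
  product_mem : ∀ (n k : ℕ) (deg : Fin n → ℕ) (a : Fin n → BiForm S), 1 ≤ n →
    (∀ i, a i ∈ part (deg i)) → k + n = ∑ i, deg i + 2 → BiForm.m n a ∈ part k

/-- The projection of a total form to its component of bidegree `(0, q)`. -/
def restrict (S : SimplicialManifold.{u}) (q : ℕ) : BiForm S →ₗ[ℂ] Form (S.obj 0) q where
  toFun a := a 0 q
  map_add' _ _ := rfl
  map_smul' _ _ := rfl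

/-! ### Words, shuffles and Lie series -/

section Words

variable {ι : Type*}

/-- The decompositions `w = u v` of a word, as pairs `(u, v)`. -/
def splits : List ι → List (List ι × List ι)
  | [] => [([], [])]
  | x :: w => ([], x :: w) :: (splits w).map fun p => (x :: p.1, p.2)

/-- The shuffles of two words, listed with multiplicity. -/
def shuffle : List ι → List ι → List (List ι)
  | [], v => [v]
  | x :: u, [] => [x :: u]
  | x :: u, y :: v => (shuffle u (y :: v)).map (x :: ·) ++ (shuffle (x :: u) v).map (y :: ·)
  termination_by u v => u.length + v.length

/-- The value of a function on words on the shuffle product `u ⧢ v`. -/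
def shSum {A : Type*} [AddCommMonoid A] (f : List ι → A) (u v : List ι) : A :=
  ((shuffle u v).map f).sum

/-- The convolution `w ↦ ∑_{w = u v} β (f u) (g v)`. -/
def conv {A B C : Type*} [AddCommMonoid A] [AddCommMonoid B] [AddCommMonoid C] [Module ℂ A]
    [Module ℂ B] [Module ℂ C] (β : A →ₗ[ℂ] B →ₗ[ℂ] C) (f : List ι → A) (g : List ι → B)
    (w : List ι) : C :=
  ((splits w).map fun p => β (f p.1) (g p.2)).sum

theorem shuffle_nil_right (u : List ι) : shuffle u [] = [u] := by
  cases u <;> simp [shuffle]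

theorem shSum_nil_left {A : Type*} [AddCommMonoid A] (f : List ι → A) (v : List ι) :
    shSum f [] v = f v := by simp [shSum, shuffle]

theorem shSum_nil_right {A : Type*} [AddCommMonoid A] (f : List ι → A) (v : List ι) :
    shSum f v [] = f v := by simp [shSum, shuffle_nil_right]

theorem shSum_cons {A : Type*} [AddCommMonoid A] (f : List ι → A) (x y : ι) (u v : List ι) :
    shSum f (x :: u) (y :: v) =
      shSum (fun w => f (x :: w)) u (y :: v) + shSum (fun w => f (y :: w)) (x :: u) v := by
  simp [shSum, shuffle, List.map_map, Function.comp_def]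

theorem shSum_add {A : Type*} [AddCommMonoid A] (f g : List ι → A) (u v : List ι) :
    shSum (fun w => f w + g w) u v = shSum f u v + shSum g u v := by
  simp [shSum, List.sum_map_add]

theorem shSum_map {A B : Type*} [AddCommMonoid A] [AddCommMonoid B] (T : A →+ B)
    (f : List ι → A) (u v : List ι) : shSum (fun w => T (f w)) u v = T (shSum f u v) := by
  simp [shSum, map_list_sum, List.map_map, Function.comp_def]

theorem length_of_mem_splits {w : List ι} {p : List ι × List ι} (hp : p ∈ splits w) :
    p.1.length ≤ w.length ∧ p.2.length ≤ w.length := by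
  induction w generalizing p with
  | nil => simp only [splits, List.mem_singleton] at hp; subst hp; simp
  | cons x w ih =>
    simp only [splits, List.mem_cons, List.mem_map] at hp
    rcases hp with rfl | ⟨q, hq, rfl⟩
    · simp
    · have := ih hq
      simp only [List.length_cons]
      omega

theorem splits_cons (x : ι) (w : List ι) : ∃ l : List (List ι × List ι),
    splits (x :: w) = ([], x :: w) :: (l ++ [(x :: w, [])]) ∧ ∀ p ∈ l, p.1 ≠ [] ∧ p.2 ≠ [] := by
  induction w generalizing x with
  | nil => exact ⟨[], by simp [splits], by simp⟩
  | cons y w ih =>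
    obtain ⟨l, hl, hl'⟩ := ih y
    refine ⟨([x], y :: w) :: l.map fun p => (x :: p.1, p.2), ?_, ?_⟩
    · rw [splits, hl]
      simp
    · intro p hp
      simp only [List.mem_cons, List.mem_map] at hp
      rcases hp with rfl | ⟨q, hq, rfl⟩
      · simp
      · exact ⟨by simp, (hl' q hq).2⟩

section

variable {A B C : Type*} [AddCommGroup A] [AddCommGroup B] [AddCommGroup C] [Module ℂ A]
    [Module ℂ B] [Module ℂ C] (β : A →ₗ[ℂ] B →ₗ[ℂ] C)

theorem conv_nil (f : List ι → A) (g : List ι → B) : conv β f g [] = β (f []) (g []) := by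
  simp [conv, splits]

theorem conv_cons (f : List ι → A) (g : List ι → B) (x : ι) (w : List ι) :
    conv β f g (x :: w) = β (f []) (g (x :: w)) + conv β (fun v => f (x :: v)) g w := by
  simp [conv, splits, List.map_map, Function.comp_def]

theorem conv_add_left (f f' : List ι → A) (g : List ι → B) :
    conv β (f + f') g = conv β f g + conv β f' g := by
  funext w
  simp [conv, List.sum_map_add]

theorem conv_add_right (f : List ι → A) (g g' : List ι → B) :
    conv β f (g + g') = conv β f g + conv β f g' := by
  funext w
  simp [conv, List.sum_map_add]

theorem conv_smul_left (c : ℂ) (f : List ι → A) (g : List ι → B) :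
    conv β (c • f) g = c • conv β f g := by
  funext w
  simp [conv, List.smul_sum, List.map_map, Function.comp_def]

theorem conv_smul_right (c : ℂ) (f : List ι → A) (g : List ι → B) :
    conv β f (c • g) = c • conv β f g := by
  funext w
  simp [conv, List.smul_sum, List.map_map, Function.comp_def]

/-- Compatibility of the convolution with the shuffle product. -/
theorem shSum_conv (f : List ι → A) (g : List ι → B) (u v : List ι) :
    shSum (conv β f g) u v = ((splits u).map fun p => ((splits v).map fun r =>
      β (shSum f p.1 r.1) (shSum g p.2 r.2)).sum).sum := by
  induction u generalizing f v with
  | nil => simp [shSum_nil_left, splits, conv]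
  | cons x u ihu =>
    induction v generalizing f with
    | nil => simp [shSum_nil_right, splits, conv]
    | cons y v ihv =>
      have h1 : (fun w => conv β f g (x :: w)) =
        fun w => β (f []) (g (x :: w)) + conv β (fun v => f (x :: v)) g w :=
        funext fun w => conv_cons β f g x w
      have h2 : (fun w => conv β f g (y :: w)) =
        fun w => β (f []) (g (y :: w)) + conv β (fun v => f (y :: v)) g w :=
        funext fun w => conv_cons β f g y w
      have h3 : ∀ z u v, shSum (fun w => β (f []) (g (z :: w))) u v =
          β (f []) (shSum (fun w => g (z :: w)) u v) := fun z u v =>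
        shSum_map (β (f [])).toAddMonoidHom (fun w => g (z :: w)) u v
      rw [shSum_cons, h1, h2, shSum_add, shSum_add, h3, h3, ihu, ihv]
      simp only [splits, List.map_cons, List.map_map, Function.comp_def, List.sum_cons,
        List.sum_map_add, shSum_cons, shSum_nil_left, shSum_nil_right, map_add,
        LinearMap.add_apply]
      abel

end

/-- Functions on words with values in `A` that vanish on the empty word and on all non-trivial
shuffles. For `A = ℂ` these are the Lie series, that is the primitive elements of the complete
tensor algebra. -/
def LieFun (ι : Type*) (A : Type*) [AddCommGroup A] [Module ℂ A] :
    Submodule ℂ (List ι → A) where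
  carrier := {f | f [] = 0 ∧ ∀ u v, u ≠ [] → v ≠ [] → shSum f u v = 0}
  zero_mem' := ⟨rfl, fun u v _ _ => List.sum_eq_zero fun z hz => by
    obtain ⟨w, _, rfl⟩ := List.mem_map.1 hz
    rfl⟩
  add_mem' := fun {f g} hf hg => ⟨by simp [hf.1, hg.1], fun u v hu hv => by
    have := shSum_add f g u v
    rw [hf.2 u v hu hv, hg.2 u v hu hv, add_zero] at this
    exact this⟩
  smul_mem' := fun c f hf => ⟨by simp [hf.1], fun u v hu hv => by
    have := shSum_map (c • LinearMap.id : A →ₗ[ℂ] A).toAddMonoidHom f u v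
    rw [hf.2 u v hu hv, map_zero] at this
    exact this⟩

section

variable {A B C : Type*} [AddCommGroup A] [AddCommGroup B] [AddCommGroup C] [Module ℂ A]
    [Module ℂ B] [Module ℂ C] (β : A →ₗ[ℂ] B →ₗ[ℂ] C)

theorem shSum_conv_of_mem {f : List ι → A} {g : List ι → B} (hf : f ∈ LieFun ι A)
    (hg : g ∈ LieFun ι B) {u v : List ι} (hu : u ≠ []) (hv : v ≠ []) :
    shSum (conv β f g) u v = β (f u) (g v) + β (f v) (g u) := by
  obtain ⟨x, u, rfl⟩ := List.exists_cons_of_ne_nil hu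
  obtain ⟨y, v, rfl⟩ := List.exists_cons_of_ne_nil hv
  rw [shSum_conv]
  obtain ⟨l, hl, hl'⟩ := splits_cons x u
  obtain ⟨k, hk, hk'⟩ := splits_cons y v
  have e1 : ∀ p ∈ l, ((splits (y :: v)).map fun r =>
      β (shSum f p.1 r.1) (shSum g p.2 r.2)).sum = 0 := by
    intro p hp
    refine List.sum_eq_zero fun z hz => ?_
    obtain ⟨r, hr, rfl⟩ := List.mem_map.1 hz
    by_cases h1 : r.1 = []
    · have h2 : r.2 ≠ [] := by
        intro h2
        rw [hk] at hr
        simp only [List.mem_cons, List.mem_append, List.not_mem_nil,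
          or_false] at hr
        rcases hr with rfl | hr | rfl
        · simp at h2
        · exact (hk' r hr).2 h2
        · simp at h1
      rw [hg.2 _ _ (hl' p hp).2 h2, map_zero]
    · rw [hf.2 _ _ (hl' p hp).1 h1, map_zero, LinearMap.zero_apply]
  have e2 : (l.map fun p => ((splits (y :: v)).map fun r =>
      β (shSum f p.1 r.1) (shSum g p.2 r.2)).sum).sum = 0 :=
    List.sum_eq_zero fun z hz => by
      obtain ⟨p, hp, rfl⟩ := List.mem_map.1 hz
      exact e1 p hp
  have e3 : (k.map fun r => β (f r.1) (shSum g (x :: u) r.2)).sum = 0 :=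
    List.sum_eq_zero fun z hz => by
      obtain ⟨r, hr, rfl⟩ := List.mem_map.1 hz
      rw [hg.2 _ _ (by simp) (hk' r hr).2, map_zero]
  have e4 : (k.map fun r => β (shSum f (x :: u) r.1) (g r.2)).sum = 0 :=
    List.sum_eq_zero fun z hz => by
      obtain ⟨r, hr, rfl⟩ := List.mem_map.1 hz
      rw [hf.2 _ _ (by simp) (hk' r hr).1, map_zero, LinearMap.zero_apply]
  rw [hl]
  simp only [List.map_cons, List.map_append, List.sum_cons, List.sum_append, List.map_nil,
    List.sum_nil, e2]
  rw [hk]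
  simp only [List.map_cons, List.map_append, List.sum_cons, List.sum_append, List.map_nil,
    List.sum_nil, e3, e4, shSum_nil_left, shSum_nil_right, hf.1, hg.1,
    hf.2 (x :: u) (y :: v) (by simp) (by simp), hg.2 (x :: u) (y :: v) (by simp) (by simp),
    map_zero]
  abel

/-- The bracket `w ↦ ∑_{w = u v} (β (f u) (g v) - β (f v) (g u))`, which corresponds to
`[a ⊗ x, b ⊗ y] = β a b ⊗ [x, y]`. -/
def brFun (f : List ι → A) (g : List ι → B) : List ι → C := conv β f g - conv β.flip g f

theorem brFun_mem {f : List ι → A} {g : List ι → B} (hf : f ∈ LieFun ι A)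
    (hg : g ∈ LieFun ι B) : brFun β f g ∈ LieFun ι C := by
  refine ⟨by simp [brFun, conv_nil, hf.1, hg.1], fun u v hu hv => ?_⟩
  have h : shSum (brFun β f g) u v = shSum (conv β f g) u v - shSum (conv β.flip g f) u v := by
    have h1 := shSum_add (brFun β f g) (conv β.flip g f) u v
    have h2 : (fun w => brFun β f g w + conv β.flip g f w) = conv β f g := by
      funext w
      simp [brFun]
    rw [h2] at h1
    rw [h1, add_sub_cancel_right]
  rw [h, shSum_conv_of_mem β hf hg hu hv, shSum_conv_of_mem β.flip hg hf hu hv]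
  simp only [LinearMap.flip_apply]
  abel

end

end Words

/-- Non-commutative formal power series in the letters `ι`. -/
def NCSeries (ι : Type*) := List ι → ℂ

namespace NCSeries

variable {ι : Type*}

instance : AddCommGroup (NCSeries ι) := inferInstanceAs (AddCommGroup (List ι → ℂ))

instance : Module ℂ (NCSeries ι) := inferInstanceAs (Module ℂ (List ι → ℂ))

/-- The series `g` with `g w = f (x w)`. -/
def tail (x : ι) (f : NCSeries ι) : NCSeries ι := fun w => f (x :: w)

instance : Mul (NCSeries ι) := ⟨fun f g => conv (LinearMap.mul ℂ ℂ) f g⟩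

instance : One (NCSeries ι) := ⟨fun w => if w.isEmpty then 1 else 0⟩

theorem mul_nil (f g : NCSeries ι) : (f * g) [] = f [] * g [] := conv_nil _ f g

theorem mul_cons (f g : NCSeries ι) (x : ι) (w : List ι) : (f * g) (x :: w) =
    f [] * g (x :: w) + (tail x f * g) w :=
  conv_cons _ f g x w

theorem add_mul' (f g h : NCSeries ι) : (f + g) * h = f * h + g * h := conv_add_left _ f g h

theorem smul_mul' (c : ℂ) (f h : NCSeries ι) : (c • f) * h = c • (f * h) :=
  conv_smul_left _ c f h

theorem mul_smul' (c : ℂ) (f h : NCSeries ι) : f * (c • h) = c • (f * h) :=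
  conv_smul_right _ c f h

theorem mul_assoc' (f g h : NCSeries ι) : f * g * h = f * (g * h) := by
  funext w
  induction w generalizing f with
  | nil => simp only [mul_nil, mul_assoc]
  | cons x w ih =>
    have h1 : tail x (f * g) = f [] • tail x g + tail x f * g := by
      funext v
      exact mul_cons f g x v
    rw [mul_cons, h1, add_mul', smul_mul', mul_nil, mul_cons f, mul_cons g]
    have h2 := ih (tail x f)
    change f [] * g [] * h (x :: w) + (f [] * (tail x g * h) w + (tail x f * g * h) w) = _
    rw [h2]
    ring

theorem zero_mul' (f : NCSeries ι) : 0 * f = 0 := by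
  have := smul_mul' 0 0 f
  simpa using this

theorem mul_zero' (f : NCSeries ι) : f * 0 = 0 := by
  have := mul_smul' 0 f 0
  simpa using this

instance : Ring (NCSeries ι) :=
  { (inferInstance : AddCommGroup (NCSeries ι)) with
    mul := (· * ·)
    one := 1
    left_distrib := fun f g h => conv_add_right _ f g h
    right_distrib := add_mul'
    zero_mul := zero_mul'
    mul_zero := mul_zero'
    mul_assoc := mul_assoc'
    one_mul := fun f => by
      funext w
      cases w with
      | nil => rw [mul_nil]; exact one_mul _
      | cons x w =>
        rw [mul_cons]
        have : tail x (1 : NCSeries ι) = 0 := rfl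
        rw [this, zero_mul']
        change 1 * f (x :: w) + 0 = _
        simp
    mul_one := fun f => by
      funext w
      induction w generalizing f with
      | nil => rw [mul_nil]; exact mul_one _
      | cons x w ih =>
        rw [mul_cons, ih]
        change f [] * 0 + f (x :: w) = _
        simp }

instance : Algebra ℂ (NCSeries ι) :=
  Algebra.ofModule smul_mul' mul_smul'

/-- The commutator bracket. -/
instance : LieRing (NCSeries ι) := LieRing.ofAssociativeRing

instance : LieAlgebra ℂ (NCSeries ι) := LieAlgebra.ofAssociativeAlgebra

end NCSeries

/-- The complete free Lie algebra on the letters `ι`: the Lie algebra of primitive elements of the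
complete tensor algebra. -/
def Lhat (ι : Type*) : LieSubalgebra ℂ (NCSeries ι) :=
  { LieFun ι ℂ with
    lie_mem' := fun {f g} hf hg => by
      have h : conv (LinearMap.mul ℂ ℂ) f g - conv (LinearMap.mul ℂ ℂ).flip g f ∈ LieFun ι ℂ :=
        brFun_mem (LinearMap.mul ℂ ℂ) hf hg
      have h2 : (LinearMap.mul ℂ ℂ).flip = LinearMap.mul ℂ ℂ := by
        ext
        simp
      rw [h2] at h
      exact h }

/-! ### Minimal 1-C∞-algebras and the fibre Lie algebra -/

section Fibre

variable {ι : Type*}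

/-- Closed ideals of the complete free Lie algebra, for the topology defined by the word length. -/
def IsClosedIdeal (R : LieIdeal ℂ (Lhat ι)) : Prop :=
  ∀ f : Lhat ι, (∀ n : ℕ, ∃ g ∈ R, ∀ w : List ι, w.length ≤ n → g.1 w = f.1 w) → f ∈ R

theorem isClosedIdeal_sInf {S : Set (LieIdeal ℂ (Lhat ι))} (hS : ∀ I ∈ S, IsClosedIdeal I) :
    IsClosedIdeal (sInf S) := by
  intro f hf
  rw [← SetLike.mem_coe, LieSubmodule.coe_sInf, mem_iInter₂]
  intro I hI
  refine hS I hI f fun n => ?_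
  obtain ⟨g, hg, h⟩ := hf n
  rw [← SetLike.mem_coe, LieSubmodule.coe_sInf, mem_iInter₂] at hg
  exact ⟨g, hg I hI, h⟩

/-- A minimal unital `1-C_∞`-algebra structure on `ℂ ⊕ W1 ⊕ W2`, with `W1` in degree `1` and `W2`
in degree `2`. It is given by the components `W1[1]^{⊗ n} → W2[1]` of the codifferential on the
tensor coalgebra in degree zero. The linear component vanishes (minimality), all components vanish
on non-trivial shuffles, and `W2` is spanned by the values. -/
structure MinimalOneCInf (W1 W2 : Type*) [AddCommGroup W1] [Module ℂ W1] [AddCommGroup W2]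
    [Module ℂ W2] where
  op : ∀ n : ℕ, MultilinearMap ℂ (fun _ : Fin n => W1) W2
  op_zero : op 0 = 0
  op_one : op 1 = 0
  op_shuffle : ∀ u v : List W1, u ≠ [] → v ≠ [] → shSum (fun w => op w.length w.get) u v = 0
  span_op : Submodule.span ℂ {y : W2 | ∃ (n : ℕ) (x : Fin n → W1), op n x = y} = ⊤

namespace MinimalOneCInf

variable {W1 W2 : Type*} [AddCommGroup W1] [Module ℂ W1] [AddCommGroup W2] [Module ℂ W2]
  (m : MinimalOneCInf W1 W2) (b : Module.Basis ι ℂ W1)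

/-- The image of `Y` in the dual of `W2` under the dual of the codifferential, as a series in the
basis dual to `b`. -/
def rel (Y : W2 →ₗ[ℂ] ℂ) : NCSeries ι := fun w => Y (m.op (w.map b).length (w.map b).get)

theorem shuffle_map {α β : Type*} (f : α → β) (u v : List α) :
    shuffle (u.map f) (v.map f) = (shuffle u v).map (List.map f) := by
  induction u generalizing v with
  | nil => simp [shuffle]
  | cons x u ihu =>
    induction v with
    | nil => simp [shuffle]
    | cons y v ihv =>
      have h1 := ihu (y :: v)
      simp only [List.map_cons] at h1 ihv ⊢
      rw [shuffle, shuffle, h1, ihv]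
      simp [List.map_map, Function.comp_def]

theorem rel_mem (Y : W2 →ₗ[ℂ] ℂ) : m.rel b Y ∈ Lhat ι := by
  refine ⟨?_, fun u v hu hv => ?_⟩
  · change Y (m.op 0 _) = 0
    rw [m.op_zero]
    exact map_zero Y
  · have h := m.op_shuffle (u.map b) (v.map b) (by simpa using hu) (by simpa using hv)
    have h2 := congrArg Y h
    rw [map_zero, shSum, shuffle_map, map_list_sum, List.map_map, List.map_map] at h2
    exact h2

/-- The closed Lie ideal generated by the image of the dual of the codifferential. -/
def relIdeal : LieIdeal ℂ (Lhat ι) :=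
  sInf {I | IsClosedIdeal I ∧ ∀ Y : W2 →ₗ[ℂ] ℂ, (⟨m.rel b Y, m.rel_mem b Y⟩ : Lhat ι) ∈ I}

theorem isClosedIdeal_relIdeal : IsClosedIdeal (m.relIdeal b) :=
  isClosedIdeal_sInf fun _ hI => hI.1

/-- The fibre Lie algebra: the quotient of the complete free Lie algebra on the dual of `W1[1]` by
the closed ideal of relations. -/
abbrev Fibre := Lhat ι ⧸ m.relIdeal b

end MinimalOneCInf

/-- A pronilpotent Lie algebra: the quotients by the terms of the lower central series are finite
dimensional, and the map to their projective limit is bijective. -/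
structure IsPronilpotent (L : Type*) [LieRing L] [LieAlgebra ℂ L] : Prop where
  finite : ∀ i, FiniteDimensional ℂ (L ⧸ LieModule.lowerCentralSeries ℂ L L i)
  injective : ∀ x : L, (∀ i, x ∈ LieModule.lowerCentralSeries ℂ L L i) → x = 0
  surjective : ∀ x : ℕ → L, (∀ i, x (i + 1) - x i ∈ LieModule.lowerCentralSeries ℂ L L i) →
    ∃ y, ∀ i, y - x i ∈ LieModule.lowerCentralSeries ℂ L L i

/-! ### The completed tensor product with the fibre Lie algebra -/

variable {A B C : Type*} [AddCommGroup A] [AddCommGroup B] [AddCommGroup C] [Module ℂ A]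
    [Module ℂ B] [Module ℂ C]

theorem LieFun.comp_mem (T : A →ₗ[ℂ] B) {f : List ι → A} (hf : f ∈ LieFun ι A) :
    (fun w => T (f w)) ∈ LieFun ι B :=
  ⟨by simp [hf.1], fun u v hu hv => by
    have := shSum_map T.toAddMonoidHom f u v
    rw [hf.2 u v hu hv, map_zero] at this
    exact this⟩

/-- Functions on words all of whose coordinates, under linear functionals of `A`, are series
in `R`. -/
def InHat (R : LieIdeal ℂ (Lhat ι)) (f : List ι → A) : Prop :=
  ∀ φ : A →ₗ[ℂ] ℂ, ∃ g ∈ R, g.1 = fun w => φ (f w)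

/-- The subspace `A ⊗̂ R` of `A ⊗̂ Lhat`. -/
def hat (R : LieIdeal ℂ (Lhat ι)) (A : Type*) [AddCommGroup A] [Module ℂ A] :
    Submodule ℂ (LieFun ι A) where
  carrier := {f | InHat R f.1}
  zero_mem' := fun φ => ⟨0, R.zero_mem, by
    funext w
    exact (map_zero φ).symm⟩
  add_mem' := fun {f g} hf hg φ => by
    obtain ⟨x, hx, hx'⟩ := hf φ
    obtain ⟨y, hy, hy'⟩ := hg φ
    refine ⟨x + y, R.add_mem hx hy, ?_⟩
    funext w
    have e : (x + y).1 w = x.1 w + y.1 w := rfl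
    rw [e, hx', hy']
    exact (map_add φ _ _).symm
  smul_mem' := fun c f hf φ => by
    obtain ⟨x, hx, hx'⟩ := hf φ
    refine ⟨c • x, R.smul_mem c hx, ?_⟩
    funext w
    have e : (c • x).1 w = c * x.1 w := rfl
    rw [e, hx']
    exact (map_smul φ c _).symm

/-- The degree zero convolution space: functions on words with values in `A` vanishing on
non-trivial shuffles, modulo the relations `R`. For a closed ideal `R` this is the completed tensor
product of `A` with the quotient of `Lhat ι` by `R`; for `A = ℂ` it is that quotient itself. -/
abbrev Conv (R : LieIdeal ℂ (Lhat ι)) (A : Type*) [AddCommGroup A] [Module ℂ A] :=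
  LieFun ι A ⧸ hat R A

/-- The map induced by a linear map of coefficients on functions on words. -/
def LieFun.map (T : A →ₗ[ℂ] B) : LieFun ι A →ₗ[ℂ] LieFun ι B where
  toFun f := ⟨fun w => T (f.1 w), LieFun.comp_mem T f.2⟩
  map_add' f g := by
    apply Subtype.ext
    funext w
    exact map_add T _ _
  map_smul' c f := by
    apply Subtype.ext
    funext w
    exact map_smul T _ _

/-- The map `T ⊗̂ id` induced by a linear map of coefficients. -/
def Conv.map (R : LieIdeal ℂ (Lhat ι)) (T : A →ₗ[ℂ] B) : Conv R A →ₗ[ℂ] Conv R B :=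
  Submodule.mapQ _ _ (LieFun.map T) fun _ hf φ => hf (φ.comp T)

theorem conv_expand (β : A →ₗ[ℂ] B →ₗ[ℂ] C) (ℓ : C →ₗ[ℂ] ℂ) {N : ℕ} (e : Fin N → B)
    (φ : Fin N → B →ₗ[ℂ] ℂ) (f : List ι → A) (g : List ι → B) (w : List ι)
    (h : ∀ v, v.length ≤ w.length → g v = ∑ k, φ k (g v) • e k) :
    ℓ (conv β f g w) = ∑ k, conv (LinearMap.mul ℂ ℂ) (fun v => ℓ (β (f v) (e k)))
      (fun v => φ k (g v)) w := by
  have key : ∀ l : List (List ι × List ι), (∀ p ∈ l, p.2.length ≤ w.length) →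
      ℓ ((l.map fun p => β (f p.1) (g p.2)).sum) =
        ∑ k, (l.map fun p => LinearMap.mul ℂ ℂ (ℓ (β (f p.1) (e k))) (φ k (g p.2))).sum := by
    intro l
    induction l with
    | nil => intro _; simp
    | cons p l ih =>
      intro hl
      have h1 := ih fun q hq => hl q (List.mem_cons_of_mem _ hq)
      have h2 := h p.2 (hl p List.mem_cons_self)
      simp only [List.map_cons, List.sum_cons, map_add, h1, Finset.sum_add_distrib]
      congr 1
      conv_lhs => rw [h2]
      simp [map_sum, mul_comm]
  exact key _ fun p hp => (length_of_mem_splits hp).2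

theorem conv_expand_flip (β : A →ₗ[ℂ] B →ₗ[ℂ] C) (ℓ : C →ₗ[ℂ] ℂ) {N : ℕ} (e : Fin N → B)
    (φ : Fin N → B →ₗ[ℂ] ℂ) (f : List ι → A) (g : List ι → B) (w : List ι)
    (h : ∀ v, v.length ≤ w.length → g v = ∑ k, φ k (g v) • e k) :
    ℓ (conv β.flip g f w) = ∑ k, conv (LinearMap.mul ℂ ℂ)
      (fun v => φ k (g v)) (fun v => ℓ (β (f v) (e k))) w := by
  have key : ∀ l : List (List ι × List ι), (∀ p ∈ l, p.1.length ≤ w.length) →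
      ℓ ((l.map fun p => β.flip (g p.1) (f p.2)).sum) =
        ∑ k, (l.map fun p => LinearMap.mul ℂ ℂ (φ k (g p.1)) (ℓ (β (f p.2) (e k)))).sum := by
    intro l
    induction l with
    | nil => intro _; simp
    | cons p l ih =>
      intro hl
      have h1 := ih fun q hq => hl q (List.mem_cons_of_mem _ hq)
      have h2 := h p.1 (hl p List.mem_cons_self)
      simp only [List.map_cons, List.sum_cons, map_add, h1, Finset.sum_add_distrib]
      congr 1
      conv_lhs => rw [h2]
      simp [map_sum]
  exact key _ fun p hp => (length_of_mem_splits hp).1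

variable [Finite ι]

theorem InHat.brFun_left {R : LieIdeal ℂ (Lhat ι)} (hR : IsClosedIdeal R)
    (β : A →ₗ[ℂ] B →ₗ[ℂ] C) {f : List ι → A} {g : List ι → B} (hf : f ∈ LieFun ι A)
    (hf' : InHat R f) (hg : g ∈ LieFun ι B) : InHat R (brFun β f g) := by
  intro ℓ
  have hmem : (fun w => ℓ (brFun β f g w)) ∈ LieFun ι ℂ := LieFun.comp_mem ℓ (brFun_mem β hf hg)
  refine ⟨⟨_, hmem⟩, hR _ fun n => ?_, rfl⟩
  set S : Submodule ℂ B := Submodule.span ℂ (g '' {w | w.length ≤ n}) with hS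
  have hfin : FiniteDimensional ℂ S :=
    FiniteDimensional.span_of_finite ℂ ((List.finite_length_le ι n).image g)
  let bS := Module.finBasis ℂ S
  have hext : ∀ k, ∃ φ : B →ₗ[ℂ] ℂ, φ ∘ₗ S.subtype = bS.coord k := fun k =>
    LinearMap.exists_extend (bS.coord k)
  choose φ hφ using hext
  have hexp : ∀ v, v.length ≤ n → g v = ∑ k, φ k (g v) • (bS k : B) := by
    intro v hv
    have hvS : g v ∈ S := Submodule.subset_span ⟨v, hv, rfl⟩
    have h1 := bS.sum_repr ⟨g v, hvS⟩
    have h2 := congrArg S.subtype h1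
    rw [map_sum] at h2
    refine Eq.trans h2.symm (Finset.sum_congr rfl fun k _ => ?_)
    have h3 := LinearMap.congr_fun (hφ k) ⟨g v, hvS⟩
    simp only [LinearMap.comp_apply, Submodule.subtype_apply, Module.Basis.coord_apply] at h3
    simp [h3]
  have hG : ∀ k, ∃ x ∈ R, x.1 = fun w => ℓ (β (f w) (bS k : B)) := fun k =>
    hf' (ℓ.comp (β.flip (bS k : B)))
  choose G hGR hG' using hG
  refine ⟨∑ k, ⁅G k, (⟨fun w => φ k (g w), LieFun.comp_mem (φ k) hg⟩ : Lhat ι)⁆,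
    sum_mem fun k _ => lie_mem_left ℂ (Lhat ι) R _ _ (hGR k), fun w hw => ?_⟩
  have hc : ∀ F : Fin (Module.finrank ℂ S) → Lhat ι, (∑ k, F k : Lhat ι).1 w = ∑ k, (F k).1 w := by
    intro F
    rw [AddSubmonoidClass.coe_finsetSum]
    exact Finset.sum_apply (M := fun _ : List ι => ℂ) w _ _
  rw [hc]
  have e1 := conv_expand β ℓ (fun k => (bS k : B)) φ f g w fun v hv => hexp v (hv.trans hw)
  have e2 := conv_expand_flip β ℓ (fun k => (bS k : B)) φ f g w fun v hv => hexp v (hv.trans hw)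
  have e3 : ℓ (brFun β f g w) = ℓ (conv β f g w) - ℓ (conv β.flip g f w) := map_sub ℓ _ _
  change _ = ℓ (brFun β f g w)
  rw [e3, e1, e2, ← Finset.sum_sub_distrib]
  refine Finset.sum_congr rfl fun k _ => ?_
  rw [← hG' k]
  rfl

theorem InHat.brFun_right {R : LieIdeal ℂ (Lhat ι)} (hR : IsClosedIdeal R)
    (β : A →ₗ[ℂ] B →ₗ[ℂ] C) {f : List ι → A} {g : List ι → B} (hf : f ∈ LieFun ι A)
    (hg : g ∈ LieFun ι B) (hg' : InHat R g) : InHat R (brFun β f g) := by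
  intro ℓ
  obtain ⟨x, hx, hx'⟩ := InHat.brFun_left hR β.flip hg hg' hf ℓ
  refine ⟨-x, neg_mem hx, ?_⟩
  funext w
  have e : (-x).1 w = -x.1 w := rfl
  rw [e, hx']
  have e2 : brFun β f g w = -brFun β.flip g f w := by
    simp [brFun]
  rw [e2, map_neg]

/-- The bracket on functions on words induced by a bilinear map of coefficients. -/
def LieFun.bracket (β : A →ₗ[ℂ] B →ₗ[ℂ] C) :
    LieFun ι A →ₗ[ℂ] LieFun ι B →ₗ[ℂ] LieFun ι C :=
  LinearMap.mk₂ ℂ (fun f g => ⟨brFun β f.1 g.1, brFun_mem β f.2 g.2⟩)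
    (fun f f' g => by
      apply Subtype.ext
      simp only [brFun, Submodule.coe_add, conv_add_left, conv_add_right]
      abel)
    (fun c f g => by
      apply Subtype.ext
      simp only [brFun, Submodule.coe_smul, conv_smul_left, conv_smul_right, smul_sub])
    (fun f g g' => by
      apply Subtype.ext
      simp only [brFun, Submodule.coe_add, conv_add_left, conv_add_right]
      abel)
    (fun c f g => by
      apply Subtype.ext
      simp only [brFun, Submodule.coe_smul, conv_smul_left, conv_smul_right, smul_sub])

theorem LieFun.hat_le_comap {R : LieIdeal ℂ (Lhat ι)} (hR : IsClosedIdeal R)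
    (β : A →ₗ[ℂ] B →ₗ[ℂ] C) (f : LieFun ι A) :
    hat R B ≤ (hat R C).comap (LieFun.bracket β f) :=
  fun g hg => InHat.brFun_right hR β f.2 g.2 hg

/-- The bracket `[a ⊗ x, b ⊗ y] = β a b ⊗ [x, y]` on completed tensor products. -/
def Conv.bracket {R : LieIdeal ℂ (Lhat ι)} (hR : IsClosedIdeal R) (β : A →ₗ[ℂ] B →ₗ[ℂ] C) :
    Conv R A →ₗ[ℂ] Conv R B →ₗ[ℂ] Conv R C :=
  Submodule.liftQ (hat R A)
    { toFun := fun f => Submodule.mapQ (hat R B) (hat R C) (LieFun.bracket β f)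
        (LieFun.hat_le_comap hR β f)
      map_add' := fun f f' => by
        ext g
        simp only [LinearMap.comp_apply, Submodule.mkQ_apply, Submodule.mapQ_apply,
          LinearMap.add_apply, map_add, Submodule.Quotient.mk_add]
      map_smul' := fun c f => by
        ext g
        simp only [LinearMap.comp_apply, Submodule.mkQ_apply, Submodule.mapQ_apply,
          LinearMap.smul_apply, map_smul, Submodule.Quotient.mk_smul, RingHom.id_apply] }
    (fun f hf => by
      rw [LinearMap.mem_ker]
      ext g
      simp only [LinearMap.coe_mk, AddHom.coe_mk, LinearMap.comp_apply, Submodule.mkQ_apply,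
        Submodule.mapQ_apply, LinearMap.zero_apply]
      rw [Submodule.Quotient.mk_eq_zero]
      exact InHat.brFun_left hR β f.2 hf g.2)

end Fibre

/-! ### Maurer-Cartan elements of the degree zero convolution algebra -/

section MaurerCartan

variable {ι : Type*} {S : SimplicialManifold.{u}}

/-- The operations `M_k(f_1, …, f_k)(w) = ∑ (-1)^k m_k(f_1(w_1), …, f_k(w_k))` on functions on
words, the sum over all decompositions of `w` into `k` non-empty words `w_1, …, w_k`. -/
def convOp (k : ℕ) (f : Fin k → List ι → BiForm S) (w : List ι) : BiForm S :=
  ∑ c ∈ (Finset.univ : Finset (Composition w.length)).filter (fun c => c.length = k),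
    (-1 : ℂ) ^ k • BiForm.m k fun i => f i ((w.splitWrtComposition c).getD i [])

/-- The brackets `l_k(f_1, …, f_k) = ∑_σ M_k(f_{σ 1}, …, f_{σ k})` on elements of degree one. The
signs of the antisymmetrisation are all `1` in this degree. -/
def convBracket (k : ℕ) (f : Fin k → List ι → BiForm S) (w : List ι) : BiForm S :=
  ∑ σ : Equiv.Perm (Fin k), convOp k (fun i => f (σ i)) w

/-- The left hand side `∑_{k ≥ 1} (1 / k!) l_k(f, …, f)` of the Maurer-Cartan equation. On a given
word only finitely many summands are non-zero. -/
def mcCurvature (f : List ι → BiForm S) (w : List ι) : BiForm S :=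
  ∑ k ∈ Finset.Icc 1 w.length, ((k.factorial : ℂ))⁻¹ • convBracket k (fun _ => f) w

/-- Maurer-Cartan elements of the degree zero convolution `L_∞`-algebra with coefficients in a
subalgebra `B`: classes of degree one elements for which the left hand side of the Maurer-Cartan
equation lies in the subspace generated by the relations `R`. -/
def IsMaurerCartan (B : CInfSubalgebra S) {R : LieIdeal ℂ (Lhat ι)}
    (c : Conv R (B.part 1)) : Prop :=
  ∃ f : LieFun ι (B.part 1), Submodule.Quotient.mk f = c ∧
    InHat R (mcCurvature fun w => (f.1 w : BiForm S))

/-- The map `r_*` induced by the projection onto the component of bidegree `(0, 1)`. -/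
def restrictConn (B : CInfSubalgebra S) (R : LieIdeal ℂ (Lhat ι)) :
    Conv R (B.part 1) →ₗ[ℂ] Conv R (Form (S.obj 0) 1) :=
  Conv.map R ((restrict S 1).comp (B.part 1).subtype)

end MaurerCartan

/-! ### Connections on the trivial bundle with fibre `Lhat ι / R`

Forms with values in the fibre are the elements of `Conv R (Form X k)`. -/

section Connection

variable {ι : Type*} [Finite ι] {X : ComplexManifold.{u}} {R : LieIdeal ℂ (Lhat ι)}

/-- The operator `∇ s = d s - [α, s]` on `k`-forms with values in the fibre, for a connection
form `α` acting through the adjoint action. -/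
def nabla (hR : IsClosedIdeal R) (α : Conv R (Form X 1)) (k : ℕ) :
    Conv R (Form X k) →ₗ[ℂ] Conv R (Form X (k + 1)) :=
  Conv.map R Form.d - Conv.bracket hR (Form.wedge (Nat.add_comm 1 k)) α

end Connection

/-! ### Holomorphic forms and logarithmic singularities -/

section Holomorphic

/-- Holomorphic forms: complex multilinear at every point, with holomorphic representatives in
holomorphic charts. -/
def IsHolForm {X : ComplexManifold.{u}} {q : ℕ} (θ : X → Alt X.Model q) : Prop :=
  (∀ (x : X) (v : Fin q → X.Model) (i : Fin q) (c : ℂ),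
    θ x (Function.update v i (c • v i)) = c * θ x v) ∧
  ∀ e ∈ IsManifold.maximalAtlas 𝓘(ℂ, X.Model) ω X, DifferentiableOn ℂ (rep e θ) e.target

/-- A normal crossing divisor: a family of closed subsets such that every point has a holomorphic
chart in which the members through the point are distinct coordinate hyperplanes and which does not
meet the other members. -/
structure NCDivisor (X : ComplexManifold.{u}) where
  index : Type u
  component : index → Set X
  isClosed : ∀ i, IsClosed (component i)
  exists_chart : ∀ p : X, ∃ e ∈ IsManifold.maximalAtlas 𝓘(ℂ, X.Model) ω X,
    ∃ (n : ℕ) (z : Module.Basis (Fin n) ℂ X.Model) (s : {i // p ∈ component i} → Fin n),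
      p ∈ e.source ∧ Function.Injective s ∧
      (∀ i, e.source ∩ component i.1 = {x ∈ e.source | z.coord (s i) (e x) = 0}) ∧
      ∀ i, p ∉ component i → Disjoint e.source (component i)

/-- The union of the components. -/
def NCDivisor.support {X : ComplexManifold.{u}} (D : NCDivisor X) : Set X := ⋃ i, D.component i

/-- The form `dz_k / z_k` in linear coordinates `z`. -/
def dlog {E : Type*} [NormedAddCommGroup E] [NormedSpace ℂ E] [FiniteDimensional ℂ E] {n : ℕ}
    (z : Module.Basis (Fin n) ℂ E) (k : Fin n) (y : E) : GAlt E :=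
  GAlt.ofLinear ((z.coord k y)⁻¹ •
    (LinearMap.toContinuousLinearMap (z.coord k)).restrictScalars ℝ)

/-- Forms on the complement `M` of a divisor `D ⊂ N`, embedded by `j : M → N`, with logarithmic
singularities along `D`: in all holomorphic coordinates in which the divisor is given by
`∏_{k ∈ K} z_k = 0` the form is `∑_J w_J ∧ ⋀_{k ∈ J} dz_k / z_k` with `J ⊆ K` and smooth `w_J`. -/
def IsLogForm {M N : ComplexManifold.{u}} (D : NCDivisor N) (j : M → N) {q : ℕ}
    (θ : M → Alt M.Model q) : Prop :=
  ∀ e ∈ IsManifold.maximalAtlas 𝓘(ℂ, N.Model) ω N,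
    ∀ (n : ℕ) (z : Module.Basis (Fin n) ℂ N.Model) (K : Finset (Fin n)),
      e.source ∩ D.support = {x ∈ e.source | ∃ k ∈ K, z.coord k (e x) = 0} →
      ∃ w : Finset (Fin n) → N.Model → GAlt N.Model,
        (∀ J p, ContDiffOn ℝ ∞ (fun y => w J y p) e.target) ∧
        ∀ x : M, j x ∈ e.source →
          θ x = ((∑ J ∈ K.powerset, (w J (e (j x))).wedge
              (GAlt.wedgeList ((J.sort (· ≤ ·)).map fun k => dlog z k (e (j x))))) q
            ).compContinuousLinearMap
              (mfderiv 𝓘(ℝ, M.Model) 𝓘(ℝ, N.Model) (e ∘ j) x : M.Model →L[ℝ] N.Model)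

/-- A presentation of a simplicial manifold as the complement of a simplicial normal crossing
divisor in a simplicial object of complex manifolds and holomorphic maps. -/
structure LogPair (S : SimplicialManifold.{u}) where
  total : SimplicialManifold.{u}
  holomorphic : ∀ {m n : ℕ} (f : Fin (m + 1) →o Fin (n + 1)),
    ContMDiff 𝓘(ℂ, (total.obj n).Model) 𝓘(ℂ, (total.obj m).Model) ω (total.map f)
  divisor : ∀ n, NCDivisor (total.obj n)
  preimage_subset : ∀ {m n : ℕ} (f : Fin (m + 1) →o Fin (n + 1)),
    total.map f ⁻¹' (divisor m).support ⊆ (divisor n).support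
  incl : ∀ n, S.obj n → total.obj n
  incl_holomorphic : ∀ n,
    ContMDiff 𝓘(ℂ, (S.obj n).Model) 𝓘(ℂ, (total.obj n).Model) ω (incl n)
  incl_open : ∀ n, Topology.IsOpenEmbedding (incl n)
  range_incl : ∀ n, range (incl n) = (divisor n).supportᶜ
  incl_map : ∀ {m n : ℕ} (f : Fin (m + 1) →o Fin (n + 1)) (x : S.obj n),
    incl m (S.map f x) = total.map f (incl n x)

variable {ι : Type*} {S : SimplicialManifold.{u}} {R : LieIdeal ℂ (Lhat ι)}

/-- Holomorphic elements of the convolution algebra: those represented by a function on words all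
of whose values are holomorphic. -/
def IsHolElement (B : CInfSubalgebra S) (c : Conv R (B.part 1)) : Prop :=
  ∃ f : LieFun ι (B.part 1), Submodule.Quotient.mk f = c ∧
    ∀ w p q, IsHolForm ((f.1 w : BiForm S) p q).1

/-- Elements of the convolution algebra that are holomorphic with logarithmic singularities. -/
def IsHolLogElement (B : CInfSubalgebra S) (L : LogPair S) (c : Conv R (B.part 1)) : Prop :=
  ∃ f : LieFun ι (B.part 1), Submodule.Quotient.mk f = c ∧
    ∀ w p q, IsHolForm ((f.1 w : BiForm S) p q).1 ∧
      IsLogForm (L.divisor p) (L.incl p) ((f.1 w : BiForm S) p q).1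

/-- Holomorphic connection forms: those with a representative whose coefficients are holomorphic
forms. -/
def IsHolConn {X : ComplexManifold.{u}} (α : Conv R (Form X 1)) : Prop :=
  ∃ f : LieFun ι (Form X 1), Submodule.Quotient.mk f = α ∧ ∀ w, IsHolForm (f.1 w).1

/-- Holomorphic connection forms with logarithmic singularities along a divisor. -/
def IsHolLogConn {X N : ComplexManifold.{u}} (D : NCDivisor N) (j : X → N)
    (α : Conv R (Form X 1)) : Prop :=
  ∃ f : LieFun ι (Form X 1), Submodule.Quotient.mk f = α ∧
    ∀ w, IsHolForm (f.1 w).1 ∧ IsLogForm D j (f.1 w).1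

end Holomorphic

end GeomConn

end

open GeomConn

/-!
The fibre is a quotient of the complete free Lie algebra `Lhat ι` on finitely many letters by a
closed ideal. By the Dynkin–Specht–Wever theorem (`dynkinSum_nil_of_mem`) a Lie series without
terms of degree at most `i + 1` is a finite sum of brackets of letters with Lie series without terms
of degree at most `i` (`Lhat.exists_sum_lie_letter`). Hence the lower central series of `Lhat ι`,
formed without closures, is the filtration by the order (`Lhat.lowerCentralSeries_eq`). Its
quotients are finite dimensional, and `Lhat ι` is complete for it. Both properties pass to the
quotient by a closed ideal (`isPronilpotent_quotient`).

In simplicial degree zero the transferred products are those of the de Rham algebra: the Whitney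
form of the point is `1`, so the binary product is the wedge product (`BiForm.product_two`), and
the products of higher arity vanish for degree reasons (`BiForm.product_zero_of_ne`). The component
of bidegree `(0, 2)` of the Maurer–Cartan equation is therefore `-d α + ½ [α, α] = 0` modulo the
relations (`restrict_mcCurvature`, `d_restrictConn`).

The Leibniz rule and the flatness of `∇ = d - [α, ·]` follow from this structure equation in the
usual way: `∇ ∇ s = -[d α, s] + [α, [α, s]]`, and `[α, [α, s]] = ½ [[α, α], s]` by the Jacobi
identity (`Conv.bracket_bracket_self`). What is needed of the algebra of forms is the associativity
of the wedge product (`wedgeCLM_assoc`), the anticommutativity of `1`-forms, the Leibniz rule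
(`extDeriv_wedge`), which associativity gives through `d = ∑ dx_m ∧ ∂_m`, and `d ∘ d = 0`.

Holomorphy and logarithmic singularities are inherited from a representative of the Maurer–Cartan
element, since its component of bidegree `(0, 1)` is one of the forms concerned.
-/

noncomputable section

namespace GeomConn

open scoped Manifold ContDiff Topology
open Set

/-! ### Shuffles and the Dynkin operator -/

section Dynkin

variable {ι : Type*}

theorem length_of_mem_shuffle {u v w : List ι} (hw : w ∈ shuffle u v) :
    w.length = u.length + v.length := by
  induction u generalizing v w with
  | nil => simp only [shuffle, List.mem_singleton] at hw; simp [hw]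
  | cons x u ihu =>
    induction v generalizing w with
    | nil => simp only [shuffle, List.mem_singleton] at hw; simp [hw]
    | cons y v ihv =>
      simp only [shuffle, List.mem_append, List.mem_map] at hw
      rcases hw with ⟨t, ht, rfl⟩ | ⟨t, ht, rfl⟩
      · have := ihu ht
        simp only [List.length_cons] at this ⊢
        omega
      · have := ihv ht
        simp only [List.length_cons] at this ⊢
        omega

theorem shSum_congr {A : Type*} [AddCommMonoid A] {f g : List ι → A} {u v : List ι}
    (h : ∀ w, w.length = u.length + v.length → f w = g w) : shSum f u v = shSum g u v := by
  rw [shSum, shSum, List.map_congr_left fun w hw => h w (length_of_mem_shuffle hw)]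

/-- The shuffle recursion on last letters. -/
theorem shSum_concat {A : Type*} [AddCommMonoid A] (f : List ι → A) (x y : ι) (u v : List ι) :
    shSum f (u ++ [x]) (v ++ [y]) =
      shSum (fun w => f (w ++ [x])) u (v ++ [y]) + shSum (fun w => f (w ++ [y])) (u ++ [x]) v := by
  induction u generalizing f v with
  | nil =>
    induction v generalizing f with
    | nil => simp [shSum_cons, shSum_nil_left, shSum_nil_right, add_comm]
    | cons z v ih =>
      have := ih fun w => f (z :: w)
      simp only [List.nil_append, List.cons_append, shSum_cons, shSum_nil_left] at this ⊢
      rw [this]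
      abel
  | cons a u ihu =>
    induction v generalizing f with
    | nil =>
      have := ihu (fun w => f (a :: w)) []
      simp only [List.nil_append, List.cons_append, shSum_cons, shSum_nil_right] at this ⊢
      rw [this]
      abel
    | cons z v ihv =>
      have h1 := ihu (fun w => f (a :: w)) (z :: v)
      have h2 := ihv fun w => f (z :: w)
      simp only [List.cons_append, shSum_cons] at h1 h2 ⊢
      rw [h1, h2]
      abel

theorem conv_concat {A B C : Type*} [AddCommGroup A] [AddCommGroup B] [AddCommGroup C]
    [Module ℂ A] [Module ℂ B] [Module ℂ C] (β : A →ₗ[ℂ] B →ₗ[ℂ] C) (f : List ι → A)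
    (g : List ι → B) (w : List ι) (z : ι) :
    conv β f g (w ++ [z]) = conv β f (fun v => g (v ++ [z])) w + β (f (w ++ [z])) (g []) := by
  induction w generalizing f with
  | nil => simp [conv_cons, conv_nil]
  | cons x w ih =>
    rw [List.cons_append, conv_cons, ih, conv_cons]
    simp only [List.cons_append]
    abel

/-- The adjoint of the left-normed Dynkin operator, with an accumulator `r`:
`dynkinSum f r w = ∑_{w = u y v} (-1) ^ |u| f (y (rev(u) r ⧢ v))`. For `r = []` this is the
value on `w` of the series obtained from `f` by replacing each word by the left-normed bracket
of its letters. -/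
def dynkinSum (f : List ι → ℂ) : List ι → List ι → ℂ
  | _, [] => 0
  | r, y :: v => shSum (fun w => f (y :: w)) r v - dynkinSum f (y :: r) v

theorem dynkinSum_concat (f : List ι → ℂ) (r w : List ι) (a z : ι) :
    dynkinSum f (r ++ [a]) (w ++ [z]) =
      dynkinSum (fun v => f (v ++ [z])) (r ++ [a]) w +
        dynkinSum (fun v => f (v ++ [a])) r (w ++ [z]) := by
  induction w generalizing r with
  | nil => simp [dynkinSum, shSum_nil_right]
  | cons y w ih =>
    have := ih (y :: r)
    simp only [List.cons_append, dynkinSum, shSum_concat] at this ⊢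
    rw [this]
    ring

/-- The recursion of left-normed brackets: the last letter of the bracket is either the last or
the first letter of the word. -/
theorem dynkinSum_cons_concat (f : List ι → ℂ) (m : List ι) (a z : ι) :
    dynkinSum f [] (a :: (m ++ [z])) =
      dynkinSum (fun v => f (v ++ [z])) [] (a :: m) -
        dynkinSum (fun v => f (v ++ [a])) [] (m ++ [z]) := by
  have := dynkinSum_concat f [] m a z
  simp only [List.nil_append] at this
  simp only [dynkinSum, shSum_nil_left, List.cons_append, this]
  ring

theorem dynkinSum_of_mem {f : List ι → ℂ} (hf : f ∈ LieFun ι ℂ) (a : ι) (r v : List ι) :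
    dynkinSum f (a :: r) v = -(v.length * shSum (fun w => f (a :: w)) r v) := by
  induction v generalizing a r with
  | nil => simp [dynkinSum]
  | cons y v ih =>
    have h := hf.2 (a :: r) (y :: v) (by simp) (by simp)
    rw [shSum_cons] at h
    rw [dynkinSum, ih, eq_neg_of_add_eq_zero_left h]
    push_cast [List.length_cons]
    ring

/-- The Dynkin–Specht–Wever theorem: the Dynkin operator multiplies a Lie series by the degree. -/
theorem dynkinSum_nil_of_mem {f : List ι → ℂ} (hf : f ∈ LieFun ι ℂ) (w : List ι) :
    dynkinSum f [] w = w.length * f w := by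
  cases w with
  | nil => simp [dynkinSum]
  | cons a v =>
    rw [dynkinSum, dynkinSum_of_mem hf, shSum_nil_left]
    push_cast [List.length_cons]
    ring

/-- The coefficients of a Lie series, as a function on words. The type `NCSeries ι` of the series is a
definition, which `simp` and `rw` do not unfold. -/
def lieCoeff (f : Lhat ι) (w : List ι) : ℂ := f.1 w

theorem lieCoeff_mem (f : Lhat ι) : lieCoeff f ∈ LieFun ι ℂ := f.2

theorem lieCoeff_nil (f : Lhat ι) : lieCoeff f [] = 0 := f.2.1

theorem lieCoeff_ext {f g : Lhat ι} (h : ∀ w, lieCoeff f w = lieCoeff g w) : f = g :=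
  Subtype.ext (funext h)

theorem lieCoeff_add (f g : Lhat ι) (w : List ι) :
    lieCoeff (f + g) w = lieCoeff f w + lieCoeff g w := rfl

theorem lieCoeff_sub (f g : Lhat ι) (w : List ι) :
    lieCoeff (f - g) w = lieCoeff f w - lieCoeff g w := rfl

theorem lieCoeff_smul (c : ℂ) (f : Lhat ι) (w : List ι) :
    lieCoeff (c • f) w = c * lieCoeff f w := rfl

theorem lieCoeff_lie (f g : Lhat ι) (w : List ι) :
    lieCoeff ⁅f, g⁆ w =
      conv (LinearMap.mul ℂ ℂ) (lieCoeff f) (lieCoeff g) w -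
        conv (LinearMap.mul ℂ ℂ) (lieCoeff g) (lieCoeff f) w :=
  rfl

theorem lieCoeff_sum {κ : Type*} (s : Finset κ) (F : κ → Lhat ι) (w : List ι) :
    lieCoeff (∑ k ∈ s, F k) w = ∑ k ∈ s, lieCoeff (F k) w := by
  have h : (∑ k ∈ s, F k : Lhat ι).1 = ∑ k ∈ s, (F k).1 := AddSubmonoidClass.coe_finsetSum _ _
  exact (congrFun h w).trans (Finset.sum_apply (M := fun _ : List ι => ℂ) w _ _)

open Classical in
/-- The letter `x` as a series. -/
def letter (x : ι) : Lhat ι :=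
  ⟨fun w => if w = [x] then 1 else 0, by simp, fun u v hu hv => by
    rw [shSum_congr (g := fun _ => 0) fun w hw => if_neg fun h => ?_]
    · simp [shSum]
    · have h1 := List.length_pos_iff.2 hu
      have h2 := List.length_pos_iff.2 hv
      rw [h] at hw
      simp only [List.length_cons, List.length_nil] at hw
      omega⟩

open Classical in
theorem coeff_letter (x : ι) (w : List ι) :
    lieCoeff (letter x) w = if w = [x] then 1 else 0 := rfl

theorem conv_one_right (h : List ι → ℂ) :
    conv (LinearMap.mul ℂ ℂ) h (fun w => if w.isEmpty then 1 else 0) = h :=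
  mul_one (M := NCSeries ι) h

theorem conv_one_left (h : List ι → ℂ) :
    conv (LinearMap.mul ℂ ℂ) (fun w => if w.isEmpty then 1 else 0) h = h :=
  one_mul (M := NCSeries ι) h

open Classical in
theorem conv_letter_right (h : List ι → ℂ) (x z : ι) (w : List ι) :
    conv (LinearMap.mul ℂ ℂ) h (lieCoeff (letter x)) (w ++ [z]) = if x = z then h w else 0 := by
  have e : (fun v : List ι => lieCoeff (letter x) (v ++ [z])) =
      (if x = z then (1 : ℂ) else 0) • fun w => if w.isEmpty then 1 else 0 := by
    funext v
    rw [coeff_letter]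
    cases v with
    | nil => by_cases h : z = x <;> simp [h, eq_comm (a := x)]
    | cons a v => simp
  rw [conv_concat, e, conv_smul_right, conv_one_right, lieCoeff_nil]
  simp

open Classical in
theorem conv_letter_left (h : List ι → ℂ) (x z : ι) (w : List ι) :
    conv (LinearMap.mul ℂ ℂ) (lieCoeff (letter x)) h (z :: w) = if x = z then h w else 0 := by
  have e : (fun v : List ι => lieCoeff (letter x) (z :: v)) =
      (if x = z then (1 : ℂ) else 0) • fun w => if w.isEmpty then 1 else 0 := by
    funext v
    rw [coeff_letter]
    cases v with
    | nil => by_cases h : z = x <;> simp [h, eq_comm (a := x)]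
    | cons a v => simp
  rw [conv_cons, e, conv_smul_left, conv_one_left, lieCoeff_nil]
  simp

/-- A word is empty, a letter, or has a first and a different last position. -/
theorem word_cases {P : List ι → Prop} (h0 : P []) (h1 : ∀ a, P [a])
    (h2 : ∀ a m z, P (a :: (m ++ [z]))) (w : List ι) : P w := by
  rcases w with _ | ⟨a, w⟩
  · exact h0
  · rcases List.eq_nil_or_concat w with rfl | ⟨m, z, rfl⟩
    · exact h1 a
    · simpa using h2 a m z

variable [Fintype ι]

theorem coeff_sum_lie_letter_singleton (h : ι → Lhat ι) (a : ι) :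
    lieCoeff (∑ x, ⁅h x, letter x⁆) [a] = 0 := by
  rw [lieCoeff_sum]
  refine Finset.sum_eq_zero fun x _ => ?_
  have h1 := conv_letter_right (lieCoeff (h x)) x a []
  rw [List.nil_append] at h1
  rw [lieCoeff_lie, h1, conv_letter_left, sub_self]

theorem coeff_sum_lie_letter_cons_concat (h : ι → Lhat ι) (a z : ι) (m : List ι) :
    lieCoeff (∑ x, ⁅h x, letter x⁆) (a :: (m ++ [z])) =
      lieCoeff (h z) (a :: m) - lieCoeff (h a) (m ++ [z]) := by
  classical
  have h1 : ∀ x, lieCoeff ⁅h x, letter x⁆ (a :: (m ++ [z])) =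
      (if x = z then lieCoeff (h x) (a :: m) else 0) -
        (if x = a then lieCoeff (h x) (m ++ [z]) else 0) := by
    intro x
    rw [lieCoeff_lie, conv_letter_left, ← List.cons_append, conv_letter_right]
  rw [lieCoeff_sum]
  simp [h1]

/-- The homogeneous part of degree `n + 1` of the Dynkin operator is a Lie series, being an
iterated bracket of letters. -/
theorem exists_lie_dynkinSum (n : ℕ) (f : List ι → ℂ) :
    ∃ g : Lhat ι, ∀ w, lieCoeff g w = if w.length = n + 1 then dynkinSum f [] w else 0 := by
  induction n generalizing f with
  | zero =>
    refine ⟨∑ x, f [x] • letter x, fun w => ?_⟩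
    classical
    simp only [lieCoeff_sum, lieCoeff_smul, coeff_letter]
    rcases w with _ | ⟨a, _ | ⟨b, w⟩⟩
    · simp
    · simp [dynkinSum, shSum_nil_left]
    · simp
  | succ n ih =>
    choose g hg using fun x => ih fun v => f (v ++ [x])
    refine ⟨∑ x, ⁅g x, letter x⁆, fun w => ?_⟩
    induction w using word_cases with
    | h0 => rw [lieCoeff_nil]; simp
    | h1 a => rw [coeff_sum_lie_letter_singleton]; simp
    | h2 a m z =>
      rw [coeff_sum_lie_letter_cons_concat, hg, hg, dynkinSum_cons_concat]
      simp only [List.length_cons, List.length_append, List.length_nil]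
      split_ifs <;> first | rfl | omega | simp

/-- The Dynkin operator followed by a rescaling of each degree has Lie series as values: a shuffle
relation only involves words of one length. -/
theorem dynkinSum_mem (f : List ι → ℂ) (c : ℕ → ℂ) :
    (fun w => c w.length * dynkinSum f [] w) ∈ LieFun ι ℂ := by
  refine ⟨by simp [dynkinSum], fun u v hu hv => ?_⟩
  obtain ⟨g, hg⟩ := exists_lie_dynkinSum (u.length + v.length - 1) f
  have h1 := List.length_pos_iff.2 hu
  rw [← (lieCoeff_mem (c (u.length + v.length) • g)).2 u v hu hv]
  refine shSum_congr fun w hw => ?_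
  rw [lieCoeff_smul, hg, if_pos (by omega), hw]

/-- A Lie series without terms of degree at most `i + 1` is a sum of brackets of Lie series
without terms of degree at most `i` with letters. -/
theorem Lhat.exists_sum_lie_letter {i : ℕ} (f : Lhat ι)
    (hf : ∀ w, w.length ≤ i + 1 → lieCoeff f w = 0) :
    ∃ h : ι → Lhat ι, (∀ x w, w.length ≤ i → lieCoeff (h x) w = 0) ∧
      f = ∑ x, ⁅h x, letter x⁆ := by
  -- The factor makes up for the degree in the Dynkin–Specht–Wever theorem for `f`.
  let h : ι → Lhat ι := fun x =>
    ⟨_, dynkinSum_mem (fun v => lieCoeff f (v ++ [x])) fun n => ((n : ℂ) + 1)⁻¹⟩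
  have hh : ∀ x w, lieCoeff (h x) w =
      ((w.length : ℂ) + 1)⁻¹ * dynkinSum (fun v => lieCoeff f (v ++ [x])) [] w := fun _ _ => rfl
  have hz : ∀ (F : List ι → ℂ) (r w : List ι),
      (∀ v, v.length = r.length + w.length → F v = 0) → dynkinSum F r w = 0 := by
    intro F r w
    induction w generalizing r with
    | nil => intro _; rfl
    | cons y w ih =>
      intro hF
      rw [dynkinSum, ih (y :: r) fun v hv => hF v (by simp at hv ⊢; omega),
        shSum_congr (g := fun _ => 0) fun v hv => hF _ (by simp; omega)]
      simp [shSum]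
  refine ⟨h, fun x w hw => ?_, lieCoeff_ext fun w => ?_⟩
  · rw [hh, hz _ _ _ fun v hv => hf _ (by simp at hv ⊢; omega), mul_zero]
  · induction w using word_cases with
    | h0 => rw [lieCoeff_nil, lieCoeff_nil]
    | h1 a => rw [coeff_sum_lie_letter_singleton]; exact hf _ (by simp)
    | h2 a m z =>
      have key := dynkinSum_nil_of_mem (lieCoeff_mem f) (a :: (m ++ [z]))
      rw [dynkinSum_cons_concat] at key
      rw [coeff_sum_lie_letter_cons_concat, hh, hh]
      simp only [List.length_cons, List.length_append, List.length_nil] at key ⊢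
      push_cast at key ⊢
      have hne : (m.length : ℂ) + 1 + 1 ≠ 0 := by exact_mod_cast Nat.succ_ne_zero (m.length + 1)
      rw [← mul_sub, key, inv_mul_cancel_left₀ hne]

end Dynkin

/-! ### The lower central series of a quotient of the complete free Lie algebra -/

section Pronilpotent

variable {ι : Type*}

theorem conv_eq_zero_right {A B C : Type*} [AddCommGroup A] [AddCommGroup B] [AddCommGroup C]
    [Module ℂ A] [Module ℂ B] [Module ℂ C] (β : A →ₗ[ℂ] B →ₗ[ℂ] C) (f : List ι → A)
    {g : List ι → B} {n : ℕ} (hg : ∀ w, w.length ≤ n → g w = 0) {w : List ι}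
    (hw : w.length ≤ n) : conv β f g w = 0 := by
  refine List.sum_eq_zero fun z hz => ?_
  obtain ⟨p, hp, rfl⟩ := List.mem_map.1 hz
  rw [hg _ ((length_of_mem_splits hp).2.trans hw), map_zero]

theorem conv_eq_zero_left {A B C : Type*} [AddCommGroup A] [AddCommGroup B] [AddCommGroup C]
    [Module ℂ A] [Module ℂ B] [Module ℂ C] (β : A →ₗ[ℂ] B →ₗ[ℂ] C) {f : List ι → A}
    (g : List ι → B) {n : ℕ} (hf : ∀ w, w.length ≤ n → f w = 0) {w : List ι}
    (hw : w.length ≤ n) : conv β f g w = 0 := by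
  refine List.sum_eq_zero fun z hz => ?_
  obtain ⟨p, hp, rfl⟩ := List.mem_map.1 hz
  rw [hf _ ((length_of_mem_splits hp).1.trans hw), map_zero, LinearMap.zero_apply]

/-- Bracketing with a Lie series raises the order of vanishing. -/
theorem lieCoeff_lie_eq_zero (f : Lhat ι) {g : Lhat ι} {n : ℕ}
    (hg : ∀ w, w.length ≤ n → lieCoeff g w = 0) {w : List ι} (hw : w.length ≤ n + 1) :
    lieCoeff ⁅f, g⁆ w = 0 := by
  rw [lieCoeff_lie]
  have h1 : conv (LinearMap.mul ℂ ℂ) (lieCoeff f) (lieCoeff g) w = 0 := by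
    cases w with
    | nil => rw [conv_nil, lieCoeff_nil f, map_zero, LinearMap.zero_apply]
    | cons x w =>
      rw [conv_cons, lieCoeff_nil f, map_zero, LinearMap.zero_apply, zero_add]
      exact conv_eq_zero_right _ _ hg (by simpa using hw)
  have h2 : conv (LinearMap.mul ℂ ℂ) (lieCoeff g) (lieCoeff f) w = 0 := by
    rcases List.eq_nil_or_concat w with rfl | ⟨w, x, rfl⟩
    · rw [conv_nil, lieCoeff_nil f, map_zero]
    · rw [List.concat_eq_append] at hw ⊢
      rw [conv_concat, lieCoeff_nil f, map_zero, add_zero]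
      exact conv_eq_zero_left _ _ hg (by simpa using hw)
  rw [h1, h2, sub_zero]

/-- The ideal of Lie series without terms of degree at most `n`. -/
def Lhat.orderIdeal (ι : Type*) (n : ℕ) : LieIdeal ℂ (Lhat ι) where
  carrier := {f | ∀ w : List ι, w.length ≤ n → lieCoeff f w = 0}
  zero_mem' := fun _ _ => rfl
  add_mem' := fun {f g} hf hg w hw => by rw [lieCoeff_add, hf w hw, hg w hw, add_zero]
  smul_mem' := fun c f hf w hw => by rw [lieCoeff_smul, hf w hw, mul_zero]
  lie_mem := fun {f g} hg w hw => lieCoeff_lie_eq_zero f hg (hw.trans n.le_succ)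

variable {R : LieIdeal ℂ (Lhat ι)}

/-- The projection to the quotient by an ideal, as a morphism of Lie algebras. -/
def lieMk (R : LieIdeal ℂ (Lhat ι)) : Lhat ι →ₗ⁅ℂ⁆ (Lhat ι ⧸ R) :=
  { (LieSubmodule.Quotient.mk' R : Lhat ι →ₗ[ℂ] Lhat ι ⧸ R) with map_lie' := rfl }

theorem lieMk_surjective : Function.Surjective (lieMk R) := Quot.mk_surjective

theorem lieMk_eq_zero {f : Lhat ι} : lieMk R f = 0 ↔ f ∈ R :=
  LieSubmodule.Quotient.mk_eq_zero R

variable [Fintype ι]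

/-- The lower central series of the complete free Lie algebra on finitely many letters is the
filtration by the order: no closure has to be taken. -/
theorem Lhat.lowerCentralSeries_eq (i : ℕ) :
    LieModule.lowerCentralSeries ℂ (Lhat ι) (Lhat ι) i = Lhat.orderIdeal ι i := by
  induction i with
  | zero =>
    rw [LieModule.lowerCentralSeries_zero, eq_comm, eq_top_iff]
    intro f _ w hw
    rw [List.length_eq_zero_iff.1 (Nat.le_zero.1 hw)]
    exact lieCoeff_nil f
  | succ i ih =>
    rw [LieModule.lowerCentralSeries_succ, ih]
    apply le_antisymm
    · rw [LieSubmodule.lie_le_iff]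
      exact fun f _ g hg w hw => lieCoeff_lie_eq_zero f hg hw
    · intro f hf
      obtain ⟨h, hh, rfl⟩ := Lhat.exists_sum_lie_letter f hf
      refine sum_mem fun x _ => ?_
      rw [← lie_skew]
      exact neg_mem (LieSubmodule.lie_mem_lie (LieSubmodule.mem_top _) (hh x))

theorem mem_lowerCentralSeries_quotient {i : ℕ} {x : Lhat ι ⧸ R} :
    x ∈ LieModule.lowerCentralSeries ℂ (Lhat ι ⧸ R) (Lhat ι ⧸ R) i ↔
      ∃ f ∈ Lhat.orderIdeal ι i, lieMk R f = x := by
  rw [← LieIdeal.lowerCentralSeries_map_eq i lieMk_surjective, Lhat.lowerCentralSeries_eq]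
  refine ⟨fun h => ?_, ?_⟩
  · obtain ⟨f, hf⟩ := LieIdeal.mem_map_of_surjective lieMk_surjective h
    exact ⟨f.1, f.2, hf⟩
  · rintro ⟨f, hf, rfl⟩
    exact LieIdeal.mem_map hf

/-- The quotient of the complete free Lie algebra on finitely many letters by a closed ideal is
pronilpotent: by `Lhat.lowerCentralSeries_eq` its lower central series is the image of the
filtration by the order, for which `Lhat ι` is complete. -/
theorem isPronilpotent_quotient (hR : IsClosedIdeal R) : IsPronilpotent (Lhat ι ⧸ R) where
  finite i := by
    -- Classes in the quotient are determined by the finitely many coefficients of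
    -- degree at most `i`.
    let ev : Lhat ι →ₗ[ℂ] ({w : List ι | w.length ≤ i} → ℂ) :=
      { toFun := fun f w => lieCoeff f w
        map_add' := fun _ _ => rfl
        map_smul' := fun _ _ => rfl }
    have : Finite {w : List ι | w.length ≤ i} := List.finite_length_le ι i
    have : Module.Finite ℂ (Lhat ι ⧸ LinearMap.ker ev) :=
      Module.Finite.equiv ev.quotKerEquivRange.symm
    let p : Lhat ι →ₗ[ℂ]
        (Lhat ι ⧸ R) ⧸ LieModule.lowerCentralSeries ℂ (Lhat ι ⧸ R) (Lhat ι ⧸ R) i :=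
      (LieSubmodule.Quotient.mk'
          (LieModule.lowerCentralSeries ℂ (Lhat ι ⧸ R) (Lhat ι ⧸ R) i)).toLinearMap ∘ₗ
        (lieMk R : Lhat ι →ₗ[ℂ] Lhat ι ⧸ R)
    have hp : LinearMap.ker ev ≤ LinearMap.ker p := by
      intro f hf
      refine (LieSubmodule.Quotient.mk_eq_zero _).2 (mem_lowerCentralSeries_quotient.2 ⟨f, ?_, rfl⟩)
      exact fun w hw => congrFun (LinearMap.mem_ker.1 hf) ⟨w, hw⟩
    refine Module.Finite.of_surjective ((LinearMap.ker ev).liftQ p hp) fun y => ?_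
    obtain ⟨x, rfl⟩ := LieSubmodule.Quotient.surjective_mk' _ y
    obtain ⟨f, rfl⟩ := lieMk_surjective x
    exact ⟨Submodule.Quotient.mk f, rfl⟩
  injective x hx := by
    obtain ⟨f, rfl⟩ := lieMk_surjective x
    refine lieMk_eq_zero.2 (hR f fun n => ?_)
    obtain ⟨g, hg, h⟩ := mem_lowerCentralSeries_quotient.1 (hx n)
    refine ⟨f - g, lieMk_eq_zero.1 ?_, fun w hw => ?_⟩
    · rw [map_sub, h, sub_self]
    · change lieCoeff (f - g) w = lieCoeff f w
      rw [lieCoeff_sub, hg w hw, sub_zero]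
  surjective x hx := by
    choose d hd hd' using fun i => mem_lowerCentralSeries_quotient.1 (hx i)
    obtain ⟨f₀, hf₀⟩ := lieMk_surjective (x 0)
    let s : ℕ → Lhat ι := fun i => f₀ + ∑ j ∈ Finset.range i, d j
    have hs : ∀ i, lieMk R (s i) = x i := by
      intro i
      induction i with
      | zero => simp [s, hf₀]
      | succ i ih =>
        have e : s (i + 1) = s i + d i := by simp only [s, Finset.sum_range_succ, add_assoc]
        rw [e, map_add, ih, hd', add_sub_cancel]
    -- The coefficient of a word of length `n` is the same in all `s i` with `i ≥ n`.
    have hstab : ∀ (n i : ℕ) (w : List ι), w.length ≤ n → n ≤ i →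
        lieCoeff (s i) w = lieCoeff (s n) w := by
      intro n i w hw hi
      induction i, hi using Nat.le_induction with
      | base => rfl
      | succ i hi ih =>
        have e : s (i + 1) = s i + d i := by simp only [s, Finset.sum_range_succ, add_assoc]
        rw [e, lieCoeff_add, ih, hd i w (hw.trans hi), add_zero]
    let y : Lhat ι := ⟨fun w => lieCoeff (s w.length) w, (s 0).2.1, fun u v hu hv => by
      rw [← (lieCoeff_mem (s (u.length + v.length))).2 u v hu hv]
      exact shSum_congr fun w hw => by rw [hw]⟩
    refine ⟨lieMk R y, fun i => mem_lowerCentralSeries_quotient.2 ⟨y - s i, fun w hw => ?_, ?_⟩⟩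
    · rw [lieCoeff_sub, hstab _ i w le_rfl hw]
      exact sub_self _
    · rw [map_sub, hs]

end Pronilpotent

/-! ### Associativity and commutativity of the wedge product -/

section WedgeAlgebra

variable {V : Type*}

/-- The antisymmetrisation of a function of `n` arguments. -/
def altSum {n : ℕ} (F : (Fin n → V) → ℂ) (v : Fin n → V) : ℂ :=
  ∑ σ : Equiv.Perm (Fin n), Equiv.Perm.sign σ • F (fun k => v (σ k))

theorem altSum_perm {n : ℕ} (F : (Fin n → V) → ℂ) (τ : Equiv.Perm (Fin n)) (v : Fin n → V) :
    altSum (fun u => F fun k => u (τ k)) v = Equiv.Perm.sign τ • altSum F v := by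
  symm
  rw [altSum, altSum, Finset.smul_sum, ← Equiv.sum_comp (Equiv.mulRight τ)]
  refine Finset.sum_congr rfl fun σ _ => ?_
  simp only [Equiv.coe_mulRight, Equiv.Perm.sign_mul, Equiv.Perm.mul_apply, smul_smul]
  rw [mul_comm, mul_assoc, Int.units_mul_self, mul_one]

/-- Antisymmetrising in some of the arguments first has no effect but a factor. -/
theorem altSum_altSum {m n : ℕ} {e : Fin m → Fin n} (he : Function.Injective e)
    (P : (Fin m → V) → ℂ) (Q : (Fin n → V) → ℂ)
    (hQ : ∀ τ : Equiv.Perm (Fin n), (∀ k, k ∉ range e → τ k = k) →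
      ∀ u : Fin n → V, Q (fun k => u (τ k)) = Q u) (v : Fin n → V) :
    altSum (fun u => altSum P (fun k => u (e k)) * Q u) v =
      m.factorial • altSum (fun u => P (fun k => u (e k)) * Q u) v := by
  set H : (Fin n → V) → ℂ := fun u => P (fun k => u (e k)) * Q u with hH
  -- Permutations of the selected arguments, extended by the identity.
  let ext : Equiv.Perm (Fin m) → Equiv.Perm (Fin n) := fun τ => τ.viaFintypeEmbedding ⟨e, he⟩
  have hext : ∀ τ k, ext τ (e k) = e (τ k) := fun τ k =>
    Equiv.Perm.viaFintypeEmbedding_apply_image τ ⟨e, he⟩ k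
  have hext' : ∀ τ k, k ∉ range e → ext τ k = k := fun τ k hk =>
    Equiv.Perm.viaFintypeEmbedding_apply_notMem_range τ ⟨e, he⟩ hk
  have hsign : ∀ τ, Equiv.Perm.sign (ext τ) = Equiv.Perm.sign τ := fun τ =>
    Equiv.Perm.viaFintypeEmbedding_sign τ ⟨e, he⟩
  have h1 : ∀ u : Fin n → V, altSum P (fun k => u (e k)) * Q u =
      ∑ τ : Equiv.Perm (Fin m), Equiv.Perm.sign τ • H (fun k => u (ext τ k)) := by
    intro u
    rw [altSum, Finset.sum_mul]
    refine Finset.sum_congr rfl fun τ _ => ?_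
    simp only [hH, hQ (ext τ) (hext' τ) u, hext, smul_mul_assoc]
  have h3 : altSum (fun u => altSum P (fun k => u (e k)) * Q u) v =
      ∑ τ : Equiv.Perm (Fin m), Equiv.Perm.sign τ • altSum (fun u => H fun k => u (ext τ k)) v := by
    simp only [altSum.eq_1 _ v, h1, Finset.smul_sum]
    rw [Finset.sum_comm]
    refine Finset.sum_congr rfl fun τ _ => Finset.sum_congr rfl fun σ _ => ?_
    rw [smul_comm]
  have h4 : ∀ τ : Equiv.Perm (Fin m),
      Equiv.Perm.sign τ • altSum (fun u => H fun k => u (ext τ k)) v = altSum H v := by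
    intro τ
    rw [altSum_perm, hsign, smul_smul, Int.units_mul_self, one_smul]
  rw [h3]
  simp only [h4, Finset.sum_const, Finset.card_univ, Fintype.card_perm, Fintype.card_fin]

variable [NormedAddCommGroup V] [NormedSpace ℝ V]

theorem wedgeCLM_eq_altSum {i j q : ℕ} (h : i + j = q) (a : Alt V i) (b : Alt V j)
    (v : Fin q → V) : wedgeCLM V h a b v = ((i.factorial * j.factorial : ℝ)⁻¹) •
      altSum (fun u => a (fun k => u ⟨k, by omega⟩) * b (fun k => u ⟨i + k, by omega⟩)) v :=
  wedgeCLM_apply h a b v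

/-- Associativity of the wedge product. Both sides are `1 / (i! j! k!)` times the
antisymmetrisation of the product of the three forms. -/
theorem wedgeCLM_assoc {i j k ij jk q : ℕ} (h1 : i + j = ij) (h2 : ij + k = q) (h3 : j + k = jk)
    (h4 : i + jk = q) (a : Alt V i) (b : Alt V j) (c : Alt V k) :
    wedgeCLM V h2 (wedgeCLM V h1 a b) c = wedgeCLM V h4 a (wedgeCLM V h3 b c) := by
  ext v
  have hL := altSum_altSum (V := V) (e := fun l : Fin ij => (⟨l, by omega⟩ : Fin q))
    (fun x y hxy => Fin.ext (by simpa using hxy))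
    (fun u => a (fun l => u ⟨l, by omega⟩) * b (fun l => u ⟨i + l, by omega⟩))
    (fun u => c (fun l => u ⟨ij + l, by omega⟩))
    (fun τ hτ u => by
      have : ∀ l : Fin k, τ ⟨ij + l, by omega⟩ = ⟨ij + l, by omega⟩ := fun l => hτ _ (by
        rintro ⟨x, hx⟩
        have := congrArg Fin.val hx
        simp only at this
        omega)
      simp only [this]) v
  have hR := altSum_altSum (V := V) (e := fun l : Fin jk => (⟨i + l, by omega⟩ : Fin q))
    (fun x y hxy => Fin.ext (by simpa using hxy))
    (fun u => b (fun l => u ⟨l, by omega⟩) * c (fun l => u ⟨j + l, by omega⟩))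
    (fun u => a (fun l => u ⟨l, by omega⟩))
    (fun τ hτ u => by
      have : ∀ l : Fin i, τ ⟨l, by omega⟩ = ⟨l, by omega⟩ := fun l => hτ _ (by
        rintro ⟨x, hx⟩
        have := congrArg Fin.val hx
        simp only at this
        omega)
      simp only [this]) v
  have eL : wedgeCLM V h2 (wedgeCLM V h1 a b) c v =
      ((ij.factorial * k.factorial : ℝ)⁻¹ * (i.factorial * j.factorial : ℝ)⁻¹) •
        altSum (fun u : Fin q → V =>
          altSum (fun u : Fin ij → V => a (fun l => u ⟨l, by omega⟩) *
            b (fun l => u ⟨i + l, by omega⟩)) (fun l => u ⟨l, by omega⟩) *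
          c (fun l => u ⟨ij + l, by omega⟩)) v := by
    rw [wedgeCLM_eq_altSum, mul_smul]
    congr 1
    simp only [altSum.eq_1 _ v, wedgeCLM_eq_altSum, Finset.smul_sum, smul_mul_assoc]
    refine Finset.sum_congr rfl fun σ _ => ?_
    rw [smul_comm]
  have eR : wedgeCLM V h4 a (wedgeCLM V h3 b c) v =
      ((i.factorial * jk.factorial : ℝ)⁻¹ * (j.factorial * k.factorial : ℝ)⁻¹) •
        altSum (fun u : Fin q → V =>
          altSum (fun u : Fin jk → V => b (fun l => u ⟨l, by omega⟩) *
            c (fun l => u ⟨j + l, by omega⟩)) (fun l => u ⟨i + l, by omega⟩) *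
          a (fun l => u ⟨l, by omega⟩)) v := by
    rw [wedgeCLM_eq_altSum, mul_smul]
    congr 1
    simp only [altSum.eq_1 _ v, wedgeCLM_eq_altSum, Finset.smul_sum, mul_smul_comm]
    refine Finset.sum_congr rfl fun σ _ => ?_
    rw [smul_comm, mul_comm (a _)]
  have hLR : (fun u : Fin q → V => a (fun l => u ⟨l, by omega⟩) *
        b (fun l => u ⟨i + l, by omega⟩) * c (fun l => u ⟨ij + l, by omega⟩)) =
      fun u : Fin q → V => b (fun l => u ⟨i + l, by omega⟩) *
        c (fun l => u ⟨i + (j + l), by omega⟩) * a (fun l => u ⟨l, by omega⟩) := by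
    subst h1
    funext u
    simp only [add_assoc]
    ring
  rw [eL, eR]
  refine Eq.trans (congrArg _ hL) (Eq.trans ?_ (congrArg _ hR).symm)
  dsimp only
  rw [hLR]
  have f1 : (ij.factorial : ℝ) ≠ 0 := by exact_mod_cast ij.factorial_ne_zero
  have f2 : (jk.factorial : ℝ) ≠ 0 := by exact_mod_cast jk.factorial_ne_zero
  rw [← Nat.cast_smul_eq_nsmul ℝ, ← Nat.cast_smul_eq_nsmul ℝ, smul_smul, smul_smul]
  congr 1
  field_simp

theorem wedgeCLM_one_one (a b : Alt V 1) :
    wedgeCLM V rfl a b = -wedgeCLM V (rfl : 1 + 1 = 2) b a := by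
  ext v
  rw [ContinuousAlternatingMap.neg_apply, wedgeCLM_eq_altSum, wedgeCLM_eq_altSum]
  have h := altSum_perm (fun u : Fin 2 → V => a (fun k : Fin 1 => u ⟨k, by omega⟩) *
    b (fun k : Fin 1 => u ⟨1 + k, by omega⟩)) (Equiv.swap 0 1) v
  have e : (fun u : Fin 2 → V => a (fun k : Fin 1 => u (Equiv.swap 0 1 ⟨k, by omega⟩)) *
      b (fun k : Fin 1 => u (Equiv.swap 0 1 ⟨1 + k, by omega⟩))) =
      fun u => b (fun k : Fin 1 => u ⟨k, by omega⟩) * a (fun k : Fin 1 => u ⟨1 + k, by omega⟩) := by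
    funext u
    rw [mul_comm]
    congr 2
    · funext k
      obtain rfl : k = 0 := Subsingleton.elim _ _
      exact congrArg u (Equiv.swap_apply_right 0 1)
    · funext k
      obtain rfl : k = 0 := Subsingleton.elim _ _
      exact congrArg u (Equiv.swap_apply_left 0 1)
  rw [e, Equiv.Perm.sign_swap (by simp)] at h
  rw [h]
  simp

theorem wedgeCLM_one_zero (a : Alt V 1) (f : Alt V 0) :
    wedgeCLM V (Nat.add_zero 1) a f = wedgeCLM V (Nat.zero_add 1) f a := by
  ext v
  rw [wedgeCLM_eq_altSum, wedgeCLM_eq_altSum]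
  have e : (fun u : Fin 1 → V => f (fun k : Fin 0 => u ⟨1 + k, by omega⟩) *
      a (fun k : Fin 1 => u ⟨k, by omega⟩)) =
      fun u => f (fun k : Fin 0 => u ⟨k, by omega⟩) * a (fun k : Fin 1 => u ⟨0 + k, by omega⟩) := by
    funext u
    congr 2
    · funext k; exact k.elim0
    · funext k; simp only [zero_add]
  have e' : (fun u : Fin 1 → V => a (fun k : Fin 1 => u ⟨k, by omega⟩) *
      f (fun k : Fin 0 => u ⟨1 + k, by omega⟩)) =
      fun u => f (fun k : Fin 0 => u ⟨k, by omega⟩) * a (fun k : Fin 1 => u ⟨0 + k, by omega⟩) :=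
    (funext fun _ => mul_comm _ _).trans e
  rw [e', mul_comm (Nat.factorial 1 : ℝ)]

/-- The expansion of the wedge product with a `1`-form: the sum over the permutations is sorted by
the value at `0`. -/
theorem wedgeCLM_one_left {n : ℕ} (a : Alt V 1) (η : Alt V n) (v : Fin (n + 1) → V) :
    wedgeCLM V (Nat.add_comm 1 n) a η v =
      ∑ i : Fin (n + 1), (-1 : ℂ) ^ (i : ℕ) * (a (fun _ => v i) * η (i.removeNth v)) := by
  -- The permutation with value `p.1` at `0` that maps the rest in the order given by `p.2`.
  let φ : Fin (n + 1) × Equiv.Perm (Fin n) → Equiv.Perm (Fin (n + 1)) := fun p =>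
    p.1.cycleRange.symm * Equiv.Perm.decomposeFin.symm (0, p.2)
  have h0 : ∀ p, φ p 0 = p.1 := fun p => by
    simp [φ, Equiv.Perm.decomposeFin_symm_apply_zero, Fin.cycleRange_symm_zero]
  have hs : ∀ p k, φ p k.succ = p.1.succAbove (p.2 k) := fun p k => by
    simp [φ, Equiv.Perm.decomposeFin_symm_apply_succ, Fin.cycleRange_symm_succ]
  have hφ : Function.Bijective φ := by
    rw [Fintype.bijective_iff_injective_and_card]
    refine ⟨fun p p' h => ?_, by simp [Fintype.card_perm, Nat.factorial_succ]⟩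
    have e1 : p.1 = p'.1 := by rw [← h0 p, ← h0 p', h]
    refine Prod.ext e1 (Equiv.ext fun k => ?_)
    have e2 := hs p k
    rw [h, hs, e1] at e2
    exact (Fin.succAbove_right_injective e2).symm
  have hsign : ∀ p, Equiv.Perm.sign (φ p) = (-1) ^ (p.1 : ℕ) * Equiv.Perm.sign p.2 := fun p => by
    rw [Equiv.Perm.sign_mul, Equiv.Perm.decomposeFin.symm_sign, if_pos rfl, one_mul]
    congr 1
    rw [← Fin.sign_cycleRange]
    exact Equiv.Perm.sign_inv _
  have hη : ∀ p : Fin (n + 1) × Equiv.Perm (Fin n),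
      Equiv.Perm.sign p.2 • η (fun k => v (p.1.succAbove (p.2 k))) = η (p.1.removeNth v) := by
    intro p
    have := η.toAlternatingMap.map_perm (p.1.removeNth v) p.2
    change η (fun k => v (p.1.succAbove (p.2 k))) = _ at this
    rw [this, smul_smul, Int.units_mul_self, one_smul]
    rfl
  rw [wedgeCLM_eq_altSum, altSum, ← Equiv.sum_comp (Equiv.ofBijective φ hφ),
    Fintype.sum_prod_type]
  have key : ∀ (i : Fin (n + 1)) (e : Equiv.Perm (Fin n)),
      Equiv.Perm.sign (Equiv.ofBijective φ hφ (i, e)) •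
        (a (fun k : Fin 1 => v (Equiv.ofBijective φ hφ (i, e) ⟨k, by omega⟩)) *
          η (fun k : Fin n => v (Equiv.ofBijective φ hφ (i, e) ⟨1 + k, by omega⟩))) =
      (-1 : ℂ) ^ (i : ℕ) * (a (fun _ => v i) * η (i.removeNth v)) := by
    intro i e
    have e1 : (fun k : Fin 1 => v (Equiv.ofBijective φ hφ (i, e) ⟨k, by omega⟩)) =
        fun _ => v i := by
      funext k
      obtain rfl : k = 0 := Subsingleton.elim _ _
      exact congrArg v (h0 (i, e))
    have e2 : (fun k : Fin n => v (Equiv.ofBijective φ hφ (i, e) ⟨1 + k, by omega⟩)) =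
        fun k => v (i.succAbove (e k)) := by
      funext k
      have : (⟨1 + k, by omega⟩ : Fin (n + 1)) = k.succ := Fin.ext (Nat.add_comm _ _)
      rw [this]
      exact congrArg v (hs (i, e) k)
    rw [e1, e2, Equiv.ofBijective_apply, hsign, mul_smul, ← mul_smul_comm, hη (i, e)]
    rcases Nat.even_or_odd (i : ℕ) with hi | hi <;> simp [hi.neg_one_pow]
  simp only [key, Finset.sum_const, Finset.card_univ, Fintype.card_perm, Fintype.card_fin]
  rw [← Finset.smul_sum, ← Nat.cast_smul_eq_nsmul ℝ, smul_smul]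
  have f1 : (n.factorial : ℝ) ≠ 0 := by exact_mod_cast n.factorial_ne_zero
  simp [f1]

end WedgeAlgebra

/-! ### The exterior derivative: Leibniz rule and `d ∘ d = 0` -/

section Leibniz

variable {E : Type*} [NormedAddCommGroup E] [NormedSpace ℝ E] [FiniteDimensional ℝ E]

/-- The linear coordinates with respect to a basis, as `1`-forms. -/
def coordForm {N : ℕ} (e : Module.Basis (Fin N) ℝ E) (m : Fin N) : Alt E 1 :=
  ContinuousAlternatingMap.ofSubsingleton ℝ E ℂ (0 : Fin 1)
    (Complex.ofRealCLM.comp (LinearMap.toContinuousLinearMap (e.coord m)))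

theorem coordForm_apply {N : ℕ} (e : Module.Basis (Fin N) ℝ E) (m : Fin N) (v : Fin 1 → E) :
    coordForm e m v = (e.repr (v 0) m : ℂ) := rfl

/-- In coordinates, `d = ∑ dx_m ∧ ∂_m`. -/
theorem alternatizeUncurryFin_eq_sum {N n : ℕ} (e : Module.Basis (Fin N) ℝ E)
    (L : E →L[ℝ] Alt E n) :
    ContinuousAlternatingMap.alternatizeUncurryFin L =
      ∑ m, wedgeCLM E (Nat.add_comm 1 n) (coordForm e m) (L (e m)) := by
  ext v
  rw [ContinuousAlternatingMap.alternatizeUncurryFin_apply, ContinuousAlternatingMap.sum_apply]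
  simp only [wedgeCLM_one_left, coordForm_apply]
  rw [Finset.sum_comm]
  refine Finset.sum_congr rfl fun i _ => ?_
  conv_lhs => rw [← e.sum_repr (v i)]
  simp only [map_sum, map_smul, ContinuousAlternatingMap.sum_apply,
    ContinuousAlternatingMap.smul_apply, Finset.smul_sum, Complex.real_smul]
  refine Finset.sum_congr rfl fun m _ => ?_
  rw [zsmul_eq_mul]
  push_cast
  rfl

/-- The Leibniz rule. The sign enters as the factor by which the value of the first form commutes
with all `1`-forms. -/
theorem extDeriv_wedge {i j q : ℕ} (h : i + j = q) (h1 : i + 1 + j = q + 1)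
    (h2 : i + (j + 1) = q + 1) {a : E → Alt E i} {b : E → Alt E j} {x : E}
    (ha : DifferentiableAt ℝ a x) (hb : DifferentiableAt ℝ b x) (ε : ℂ)
    (hε : ∀ l : Alt E 1, wedgeCLM E (Nat.add_comm 1 i) l (a x) = ε • wedgeCLM E rfl (a x) l) :
    extDeriv (fun y => wedgeCLM E h (a y) (b y)) x =
      wedgeCLM E h1 (extDeriv a x) (b x) + ε • wedgeCLM E h2 (a x) (extDeriv b x) := by
  let e := Module.finBasis ℝ E
  simp only [extDeriv, alternatizeUncurryFin_eq_sum e,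
    ContinuousLinearMap.fderiv_of_bilinear (wedgeCLM E h) ha hb]
  -- Moving `dx_m` past `a x` produces the sign.
  have e1 : ∀ m, wedgeCLM E (Nat.add_comm 1 q) (coordForm e m)
      (wedgeCLM E h (a x) (fderiv ℝ b x (e m))) =
      ε • wedgeCLM E h2 (a x) (wedgeCLM E (Nat.add_comm 1 j) (coordForm e m)
        (fderiv ℝ b x (e m))) := by
    intro m
    rw [← wedgeCLM_assoc (Nat.add_comm 1 i) h1, hε, wedgeCLM_smul_left,
      wedgeCLM_assoc rfl h1 (Nat.add_comm 1 j) h2]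
  have e2 : ∀ m, wedgeCLM E (Nat.add_comm 1 q) (coordForm e m)
      (wedgeCLM E h (fderiv ℝ a x (e m)) (b x)) =
      wedgeCLM E h1 (wedgeCLM E (Nat.add_comm 1 i) (coordForm e m) (fderiv ℝ a x (e m))) (b x) :=
    fun m => (wedgeCLM_assoc _ _ _ _ _ _ _).symm
  have e3 : ∀ m, wedgeCLM E (Nat.add_comm 1 q) (coordForm e m)
      (((wedgeCLM E h).precompR E (a x) (fderiv ℝ b x) +
        (wedgeCLM E h).precompL E (fderiv ℝ a x) (b x)) (e m)) =
      wedgeCLM E h1 (wedgeCLM E (Nat.add_comm 1 i) (coordForm e m) (fderiv ℝ a x (e m))) (b x) +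
      ε • wedgeCLM E h2 (a x) (wedgeCLM E (Nat.add_comm 1 j) (coordForm e m)
        (fderiv ℝ b x (e m))) := by
    intro m
    rw [← e1, ← e2, ← map_add]
    exact congrArg _ (add_comm _ _)
  simp only [e3, Finset.sum_add_distrib, map_sum, sum_apply, Finset.smul_sum]

end Leibniz

section Manifold

variable {X : ComplexManifold.{u}}

theorem IsSmoothForm.differentiableAt_rep {q : ℕ} {θ : X → Alt X.Model q} (hθ : IsSmoothForm θ)
    (x : X) : DifferentiableAt ℝ (rep (chartAt X.Model x) θ) (chartAt X.Model x x) :=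
  Form.differentiableAt_rep ⟨θ, hθ⟩ x

/-- A form at a point is recovered from its representative in the preferred chart. -/
theorem rep_comp_mfderiv {q : ℕ} (θ : X → Alt X.Model q) (x : X) :
    (rep (chartAt X.Model x) θ (chartAt X.Model x x)).compContinuousLinearMap
      (mfderiv 𝓘(ℝ, X.Model) 𝓘(ℝ, X.Model) (chartAt X.Model x) x : X.Model →L[ℝ] X.Model) =
      θ x := by
  set c := chartAt X.Model x with hc
  have hcm : c ∈ IsManifold.maximalAtlas 𝓘(ℝ, X.Model) ∞ X :=
    IsManifold.chart_mem_maximalAtlas (I := 𝓘(ℝ, X.Model)) (n := ∞) x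
  have hx : x ∈ c.source := mem_chart_source _ x
  have h : (mfderiv 𝓘(ℝ, X.Model) 𝓘(ℝ, X.Model) c.symm (c x)).comp
      (mfderiv 𝓘(ℝ, X.Model) 𝓘(ℝ, X.Model) c x) =
      mfderiv 𝓘(ℝ, X.Model) 𝓘(ℝ, X.Model) (id : X → X) x := by
    rw [← mfderiv_comp x
      ((contMDiffAt_chart_symm hcm (c.map_source hx)).mdifferentiableAt (by simp))
      ((contMDiffAt_chart hcm hx).mdifferentiableAt (by simp))]
    apply Filter.EventuallyEq.mfderiv_eq
    filter_upwards [c.open_source.mem_nhds hx] with z hz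
    exact c.left_inv hz
  rw [mfderiv_id] at h
  have h3 := congrArg (fun L : X.Model →L[ℝ] X.Model =>
    (θ (c.symm (c x))).compContinuousLinearMap L) h
  refine Eq.trans h3 ?_
  rw [c.left_inv hx]
  rfl

theorem dPt_wedge {i j q : ℕ} (h : i + j = q) (h1 : i + 1 + j = q + 1) (h2 : i + (j + 1) = q + 1)
    {a : X → Alt X.Model i} {b : X → Alt X.Model j} (ha : IsSmoothForm a) (hb : IsSmoothForm b)
    (ε : ℂ) (hε : ∀ (m : Alt X.Model i) (l : Alt X.Model 1),
      wedgeCLM X.Model (Nat.add_comm 1 i) l m = ε • wedgeCLM X.Model rfl m l) (x : X) :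
    dPt (fun y => wedgeCLM X.Model h (a y) (b y)) x =
      wedgeCLM X.Model h1 (dPt a x) (b x) + ε • wedgeCLM X.Model h2 (a x) (dPt b x) := by
  have e1 := extDeriv_wedge h h1 h2 (ha.differentiableAt_rep x) (hb.differentiableAt_rep x) ε (hε _)
  have e2 : rep (chartAt X.Model x) (fun y => wedgeCLM X.Model h (a y) (b y)) =
      fun y => wedgeCLM X.Model h (rep (chartAt X.Model x) a y) (rep (chartAt X.Model x) b y) :=
    funext fun y => wedgeCLM_comp _ _ _ _
  have e3 : ∀ (l l' : Alt X.Model (q + 1)) (T : X.Model →L[ℝ] X.Model),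
      (l + ε • l').compContinuousLinearMap T =
        l.compContinuousLinearMap T + ε • l'.compContinuousLinearMap T := fun _ _ _ => rfl
  have e4 : ∀ T : X.Model →L[ℝ] X.Model, (extDeriv
      (rep (chartAt X.Model x) fun y => wedgeCLM X.Model h (a y) (b y))
        (chartAt X.Model x x)).compContinuousLinearMap T =
      wedgeCLM X.Model h1 ((extDeriv (rep (chartAt X.Model x) a)
          (chartAt X.Model x x)).compContinuousLinearMap T)
        ((rep (chartAt X.Model x) b (chartAt X.Model x x)).compContinuousLinearMap T) +
      ε • wedgeCLM X.Model h2
        ((rep (chartAt X.Model x) a (chartAt X.Model x x)).compContinuousLinearMap T)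
        ((extDeriv (rep (chartAt X.Model x) b)
          (chartAt X.Model x x)).compContinuousLinearMap T) := by
    intro T
    rw [e2, e1, e3, wedgeCLM_comp, wedgeCLM_comp]
  exact (e4 (mfderiv 𝓘(ℝ, X.Model) 𝓘(ℝ, X.Model) (chartAt X.Model x) x)).trans
    (congrArg₂ (fun u v => wedgeCLM X.Model h1 (dPt a x) u + ε • wedgeCLM X.Model h2 v (dPt b x))
      (rep_comp_mfderiv b x) (rep_comp_mfderiv a x))

end Manifold

namespace Form

variable {X Y : ComplexManifold.{u}}

theorem wedge_apply {i j q : ℕ} (h : i + j = q) (θ : Form X i) (η : Form X j) (x : X) :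
    (wedge h θ η).1 x = wedgeCLM X.Model h (θ.1 x) (η.1 x) := rfl

theorem ext_apply {q : ℕ} {θ η : Form X q} (h : ∀ x, θ.1 x = η.1 x) : θ = η :=
  Subtype.ext (funext h)

theorem wedge_assoc {i j k ij jk q : ℕ} (h1 : i + j = ij) (h2 : ij + k = q) (h3 : j + k = jk)
    (h4 : i + jk = q) (a : Form X i) (b : Form X j) (c : Form X k) :
    wedge h2 (wedge h1 a b) c = wedge h4 a (wedge h3 b c) :=
  ext_apply fun _ => wedgeCLM_assoc h1 h2 h3 h4 _ _ _

theorem wedge_one_one (a b : Form X 1) : wedge rfl a b = -wedge (rfl : 1 + 1 = 2) b a :=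
  ext_apply fun _ => wedgeCLM_one_one _ _

theorem wedge_one_zero (a : Form X 1) (f : Form X 0) :
    wedge (Nat.add_zero 1) a f = wedge (Nat.zero_add 1) f a :=
  ext_apply fun _ => wedgeCLM_one_zero _ _

theorem d_wedge {i j q : ℕ} (h : i + j = q) (h1 : i + 1 + j = q + 1) (h2 : i + (j + 1) = q + 1)
    (a : Form X i) (b : Form X j) (ε : ℂ)
    (hε : ∀ (m : Alt X.Model i) (l : Alt X.Model 1),
      wedgeCLM X.Model (Nat.add_comm 1 i) l m = ε • wedgeCLM X.Model rfl m l) :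
    d (wedge h a b) = wedge h1 (d a) b + ε • wedge h2 a (d b) :=
  ext_apply fun x => dPt_wedge h h1 h2 a.2 b.2 ε hε x

/-- The Leibniz rule for the product of a function and a form. -/
theorem d_wedge_zero {j : ℕ} (f : Form X 0) (b : Form X j) :
    d (wedge (Nat.zero_add j) f b) =
      wedge (Nat.add_comm 1 j) (d f) b + wedge (Nat.zero_add (j + 1)) f (d b) := by
  have := d_wedge (Nat.zero_add j) (Nat.add_comm 1 j) (Nat.zero_add (j + 1)) f b 1
    fun m l => (wedgeCLM_one_zero l m).trans (one_smul ℂ _).symm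
  rwa [one_smul] at this

/-- The Leibniz rule for the wedge product of a `1`-form and a form. -/
theorem d_wedge_one {j : ℕ} (a : Form X 1) (b : Form X j) :
    d (wedge (Nat.add_comm 1 j) a b) =
      wedge (Nat.add_comm 2 j) (d a) b - wedge (Nat.add_comm 1 (j + 1)) a (d b) := by
  have := d_wedge (Nat.add_comm 1 j) (Nat.add_comm 2 j) (Nat.add_comm 1 (j + 1)) a b (-1)
    fun m l => (wedgeCLM_one_one l m).trans (neg_one_smul ℂ _).symm
  rwa [neg_one_smul, ← sub_eq_add_neg] at this

theorem d_d {q : ℕ} (θ : Form X q) : d (d θ) = 0 := by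
  refine ext_apply fun x => ?_
  set c := chartAt X.Model x with hc
  have hcm : c ∈ IsManifold.maximalAtlas 𝓘(ℝ, X.Model) ∞ X :=
    IsManifold.chart_mem_maximalAtlas (I := 𝓘(ℝ, X.Model)) (n := ∞) x
  have hx : c x ∈ c.target := mem_chart_target _ x
  have h1 : rep c (dPt θ.1) =ᶠ[𝓝 (c x)] extDeriv (rep c θ.1) := by
    filter_upwards [c.open_target.mem_nhds hx] with y hy
    exact rep_dPt hcm θ.2 hy
  have h2 : extDeriv (rep c (dPt θ.1)) (c x) = 0 := by
    rw [h1.extDeriv_eq]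
    exact extDeriv_extDeriv_apply ((θ.2 c hcm).contDiffAt (c.open_target.mem_nhds hx))
      (by simpa using (by exact_mod_cast le_top : ((2 : ℕ∞) : WithTop ℕ∞) ≤ ∞))
  exact congrArg (fun l : Alt X.Model (q + 1 + 1) => l.compContinuousLinearMap
      (mfderiv 𝓘(ℝ, X.Model) 𝓘(ℝ, X.Model) c x : X.Model →L[ℝ] X.Model)) h2

end Form

/-! ### Brackets on completed tensor products -/

section Brackets

variable {ι : Type*} {A A' B B' C C' D : Type*} [AddCommGroup A] [AddCommGroup A']
  [AddCommGroup B] [AddCommGroup B'] [AddCommGroup C] [AddCommGroup C'] [AddCommGroup D]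
  [Module ℂ A] [Module ℂ A'] [Module ℂ B] [Module ℂ B'] [Module ℂ C] [Module ℂ C'] [Module ℂ D]

theorem conv_neg (β : A →ₗ[ℂ] B →ₗ[ℂ] C) (f : List ι → A) (g : List ι → B) (w : List ι) :
    conv (-β) f g w = -conv β f g w := by
  simp [conv, List.sum_neg, List.map_map, Function.comp_def]

theorem conv_sub_left (β : A →ₗ[ℂ] B →ₗ[ℂ] C) (f f' : List ι → A) (g : List ι → B)
    (w : List ι) : conv β (f - f') g w = conv β f g w - conv β f' g w := by
  have := congrFun (conv_add_left β (f - f') f' g) w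
  rw [sub_add_cancel] at this
  exact eq_sub_of_add_eq this.symm

theorem conv_sub_right (β : A →ₗ[ℂ] B →ₗ[ℂ] C) (f : List ι → A) (g g' : List ι → B)
    (w : List ι) : conv β f (g - g') w = conv β f g w - conv β f g' w := by
  have := congrFun (conv_add_right β f (g - g') g') w
  rw [sub_add_cancel] at this
  exact eq_sub_of_add_eq this.symm

/-- A linear map that is a sum of two derivations in the factors of a bilinear map is so for the
convolution. -/
theorem map_conv (T : C →ₗ[ℂ] C') (β : A →ₗ[ℂ] B →ₗ[ℂ] C) (β₁ : A' →ₗ[ℂ] B →ₗ[ℂ] C')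
    (β₂ : A →ₗ[ℂ] B' →ₗ[ℂ] C') (S : A →ₗ[ℂ] A') (U : B →ₗ[ℂ] B')
    (h : ∀ a b, T (β a b) = β₁ (S a) b + β₂ a (U b)) (f : List ι → A) (g : List ι → B)
    (w : List ι) :
    T (conv β f g w) = conv β₁ (fun v => S (f v)) g w + conv β₂ f (fun v => U (g v)) w := by
  simp [conv, map_list_sum, List.map_map, Function.comp_def, h, List.sum_map_add]

theorem conv_assoc (γ : A →ₗ[ℂ] B →ₗ[ℂ] A') (δ : A' →ₗ[ℂ] C →ₗ[ℂ] D) (β : A →ₗ[ℂ] B' →ₗ[ℂ] D)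
    (β' : B →ₗ[ℂ] C →ₗ[ℂ] B') (h : ∀ a b c, δ (γ a b) c = β a (β' b c)) (f : List ι → A)
    (g : List ι → B) (k : List ι → C) (w : List ι) :
    conv δ (conv γ f g) k w = conv β f (conv β' g k) w := by
  induction w generalizing f with
  | nil => simp only [conv_nil, h]
  | cons x w ih =>
    have e1 : (fun v => conv γ f g (x :: v)) =
        (fun v => γ (f []) (g (x :: v))) + conv γ (fun v => f (x :: v)) g :=
      funext fun v => conv_cons γ f g x v
    have e2 : conv δ (fun v => γ (f []) (g (x :: v))) k w =
        β (f []) (conv β' (fun v => g (x :: v)) k w) := by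
      simp [conv, map_list_sum, List.map_map, Function.comp_def, h]
    rw [conv_cons, e1, conv_add_left, Pi.add_apply, ih, e2, conv_nil, h, conv_cons β, conv_cons β',
      map_add, add_assoc]

variable {R : LieIdeal ℂ (Lhat ι)}

theorem LieFun.ext_apply {f g : LieFun ι A} (h : ∀ w, f.1 w = g.1 w) : f = g :=
  Subtype.ext (funext h)

theorem Conv.map_mk (T : A →ₗ[ℂ] B) (f : LieFun ι A) :
    Conv.map R T (Submodule.Quotient.mk f) = Submodule.Quotient.mk (LieFun.map T f) := rfl

theorem Conv.map_comp (T : A →ₗ[ℂ] B) (U : B →ₗ[ℂ] C) (x : Conv R A) :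
    Conv.map R U (Conv.map R T x) = Conv.map R (U ∘ₗ T) x := by
  obtain ⟨f, rfl⟩ := Submodule.Quotient.mk_surjective _ x
  rfl

theorem Conv.map_add_left (T U : A →ₗ[ℂ] B) (x : Conv R A) :
    Conv.map R (T + U) x = Conv.map R T x + Conv.map R U x := by
  obtain ⟨f, rfl⟩ := Submodule.Quotient.mk_surjective _ x
  rfl

theorem Conv.map_zero_left (x : Conv R A) : Conv.map R (0 : A →ₗ[ℂ] B) x = 0 := by
  obtain ⟨f, rfl⟩ := Submodule.Quotient.mk_surjective _ x
  rfl

theorem brFun_self (γ : A →ₗ[ℂ] A →ₗ[ℂ] C) (hγ : ∀ a b, γ a b = -γ b a) (f : List ι → A) :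
    brFun γ f f = (2 : ℂ) • conv γ f f := by
  have e : γ.flip = -γ := by
    ext a b
    simpa using hγ b a
  funext w
  rw [brFun, e, Pi.sub_apply, conv_neg, sub_neg_eq_add, Pi.smul_apply, two_smul]

variable [Finite ι] (hR : IsClosedIdeal R)

theorem Conv.bracket_mk (β : A →ₗ[ℂ] B →ₗ[ℂ] C) (f : LieFun ι A) (g : LieFun ι B) :
    Conv.bracket hR β (Submodule.Quotient.mk f) (Submodule.Quotient.mk g) =
      Submodule.Quotient.mk (LieFun.bracket β f g) := rfl

/-- A Leibniz rule for the coefficients is one for the brackets. -/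
theorem Conv.map_bracket (T : C →ₗ[ℂ] C') (β : A →ₗ[ℂ] B →ₗ[ℂ] C) (β₁ : A' →ₗ[ℂ] B →ₗ[ℂ] C')
    (β₂ : A →ₗ[ℂ] B' →ₗ[ℂ] C') (S : A →ₗ[ℂ] A') (U : B →ₗ[ℂ] B')
    (h : ∀ a b, T (β a b) = β₁ (S a) b + β₂ a (U b)) (x : Conv R A) (y : Conv R B) :
    Conv.map R T (Conv.bracket hR β x y) =
      Conv.bracket hR β₁ (Conv.map R S x) y + Conv.bracket hR β₂ x (Conv.map R U y) := by
  obtain ⟨f, rfl⟩ := Submodule.Quotient.mk_surjective _ x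
  obtain ⟨g, rfl⟩ := Submodule.Quotient.mk_surjective _ y
  simp only [Conv.map_mk, Conv.bracket_mk, ← Submodule.Quotient.mk_add]
  congr 1
  refine LieFun.ext_apply fun w => ?_
  have e1 := map_conv T β β₁ β₂ S U h f.1 g.1 w
  have e2 := map_conv T β.flip β₂.flip β₁.flip U S
    (fun b a => (h a b).trans (add_comm _ _)) g.1 f.1 w
  have e3 : T (brFun β f.1 g.1 w) = T (conv β f.1 g.1 w) - T (conv β.flip g.1 f.1 w) :=
    map_sub T _ _
  refine e3.trans ?_
  rw [e1, e2]
  change _ = (conv β₁ _ _ w - conv β₁.flip _ _ w) + (conv β₂ _ _ w - conv β₂.flip _ _ w)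
  rw [add_comm (conv β₂.flip _ _ w), add_sub_add_comm]
  rfl

theorem Conv.bracket_zero_coeff (x : Conv R A) (y : Conv R B) :
    Conv.bracket hR (0 : A →ₗ[ℂ] B →ₗ[ℂ] C) x y = 0 := by
  obtain ⟨f, rfl⟩ := Submodule.Quotient.mk_surjective _ x
  obtain ⟨g, rfl⟩ := Submodule.Quotient.mk_surjective _ y
  have e : LieFun.bracket (0 : A →ₗ[ℂ] B →ₗ[ℂ] C) f g = 0 := LieFun.ext_apply fun w => by
    change brFun (0 : A →ₗ[ℂ] B →ₗ[ℂ] C) f.1 g.1 w = 0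
    simp [brFun, conv]
  rw [Conv.bracket_mk, e, Submodule.Quotient.mk_zero]

theorem Conv.bracket_neg_coeff (β : A →ₗ[ℂ] B →ₗ[ℂ] C) (x : Conv R A) (y : Conv R B) :
    Conv.bracket hR (-β) x y = -Conv.bracket hR β x y := by
  obtain ⟨f, rfl⟩ := Submodule.Quotient.mk_surjective _ x
  obtain ⟨g, rfl⟩ := Submodule.Quotient.mk_surjective _ y
  have e : LieFun.bracket (-β) f g = -LieFun.bracket β f g := LieFun.ext_apply fun w => by
    change conv (-β) f.1 g.1 w - conv (-β.flip) g.1 f.1 w =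
      -(conv β f.1 g.1 w - conv β.flip g.1 f.1 w)
    rw [conv_neg, conv_neg]
    abel
  rw [Conv.bracket_mk, e, Submodule.Quotient.mk_neg, ← Conv.bracket_mk hR]

/-- A linear operation on the second factor commutes with the bracket. -/
theorem Conv.map_bracket_right (T : C →ₗ[ℂ] C') (β : A →ₗ[ℂ] B →ₗ[ℂ] C)
    (β' : A →ₗ[ℂ] B' →ₗ[ℂ] C') (U : B →ₗ[ℂ] B') (h : ∀ a b, T (β a b) = β' a (U b))
    (x : Conv R A) (y : Conv R B) :
    Conv.map R T (Conv.bracket hR β x y) = Conv.bracket hR β' x (Conv.map R U y) := by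
  have := Conv.map_bracket hR T β (0 : A →ₗ[ℂ] B →ₗ[ℂ] C') β' LinearMap.id U
    (fun a b => by simp [h]) x y
  rw [this, Conv.bracket_zero_coeff, zero_add]

/-- The Jacobi identity for an element `x` of odd degree: `[x, [x, y]] = ½ [[x, x], y]`, where the
products of the coefficients are associative and those of coefficients of `x` anticommute. -/
theorem Conv.bracket_bracket_self (γ : A →ₗ[ℂ] A →ₗ[ℂ] A') (δ : A' →ₗ[ℂ] B →ₗ[ℂ] C')
    (β : A →ₗ[ℂ] B →ₗ[ℂ] C) (β' : A →ₗ[ℂ] C →ₗ[ℂ] C')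
    (h : ∀ a a' b, δ (γ a a') b = β' a (β a' b)) (hγ : ∀ a b, γ a b = -γ b a)
    (x : Conv R A) (y : Conv R B) :
    Conv.bracket hR β' x (Conv.bracket hR β x y) =
      (1 / 2 : ℂ) • Conv.bracket hR δ (Conv.bracket hR γ x x) y := by
  obtain ⟨f, rfl⟩ := Submodule.Quotient.mk_surjective _ x
  obtain ⟨g, rfl⟩ := Submodule.Quotient.mk_surjective _ y
  simp only [Conv.bracket_mk, ← Submodule.Quotient.mk_smul]
  congr 1
  refine LieFun.ext_apply fun w => ?_
  have hγ' : γ.flip = -γ := by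
    ext a b
    simpa using hγ b a
  have e1 : conv δ (conv γ f.1 f.1) g.1 w = conv β' f.1 (conv β f.1 g.1) w :=
    conv_assoc γ δ β' β h f.1 f.1 g.1 w
  have e2 : conv β'.flip (conv β.flip g.1 f.1) f.1 w = -conv δ.flip g.1 (conv γ f.1 f.1) w := by
    rw [conv_assoc β.flip β'.flip (-δ.flip) γ (fun b a a' => ?_), conv_neg]
    simp only [LinearMap.flip_apply, LinearMap.neg_apply]
    rw [← h, hγ, map_neg, LinearMap.neg_apply]
  have e3 : conv β'.flip (conv β f.1 g.1) f.1 w = -conv β' f.1 (conv β.flip g.1 f.1) w := by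
    rw [conv_assoc β β'.flip (-β') β.flip (fun a b a' => ?_), conv_neg]
    simp only [LinearMap.flip_apply, LinearMap.neg_apply]
    rw [← h, ← h, hγ, map_neg, LinearMap.neg_apply]
  change brFun β' f.1 (brFun β f.1 g.1) w = (1 / 2 : ℂ) • brFun δ (brFun γ f.1 f.1) g.1 w
  rw [brFun_self γ hγ]
  simp only [brFun, Pi.sub_apply, conv_sub_left, conv_sub_right, conv_smul_left, conv_smul_right,
    Pi.smul_apply, ← smul_sub, smul_smul]
  rw [e1, e2, e3]
  norm_num
  abel

end Brackets

/-! ### Flatness of the connection -/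

section Connection

variable {ι : Type*} [Finite ι] {X : ComplexManifold.{u}} {R : LieIdeal ℂ (Lhat ι)}
  (hR : IsClosedIdeal R)

theorem nabla_apply (α : Conv R (Form X 1)) {k : ℕ} (s : Conv R (Form X k)) :
    nabla hR α k s =
      Conv.map R Form.d s - Conv.bracket hR (Form.wedge (Nat.add_comm 1 k)) α s := rfl

theorem nabla_smul (α : Conv R (Form X 1)) (f : Form X 0) (s : Conv R (Form X 0)) :
    nabla hR α 0 (Conv.map R (Form.wedge (Nat.zero_add 0) f) s) =
      Conv.map R (Form.wedge (Nat.add_zero 1) (Form.d f)) s +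
        Conv.map R (Form.wedge (Nat.zero_add 1) f) (nabla hR α 0 s) := by
  have h1 : Form.d ∘ₗ Form.wedge (Nat.zero_add 0) f =
      Form.wedge (Nat.add_zero 1) (Form.d f) + Form.wedge (Nat.zero_add 1) f ∘ₗ Form.d :=
    LinearMap.ext fun s => Form.d_wedge_zero f s
  have h2 : Conv.map R (Form.wedge (Nat.zero_add 1) f)
      (Conv.bracket hR (Form.wedge (Nat.add_comm 1 0)) α s) =
      Conv.bracket hR (Form.wedge (Nat.add_comm 1 0)) α
        (Conv.map R (Form.wedge (Nat.zero_add 0) f) s) := by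
    refine Conv.map_bracket_right hR _ _ _ _ (fun a b => ?_) α s
    rw [← Form.wedge_assoc (Nat.zero_add 1) (Nat.add_zero 1) (Nat.add_zero 1) (Nat.zero_add 1),
      ← Form.wedge_one_zero,
      Form.wedge_assoc (Nat.add_zero 1) (Nat.add_zero 1) (Nat.zero_add 0) (Nat.add_zero 1)]
  rw [nabla_apply, nabla_apply, map_sub, h2, Conv.map_comp, h1, Conv.map_add_left, Conv.map_comp]
  abel

/-- A connection form with `d α = ½ [α, α]` is flat. -/
theorem nabla_nabla {α : Conv R (Form X 1)}
    (hα : Conv.map R Form.d α = (1 / 2 : ℂ) • Conv.bracket hR (Form.wedge rfl) α α) {k : ℕ}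
    (s : Conv R (Form X k)) : nabla hR α (k + 1) (nabla hR α k s) = 0 := by
  have h1 : Conv.map R Form.d (Conv.map R Form.d s) = 0 := by
    rw [Conv.map_comp, show Form.d ∘ₗ Form.d = (0 : Form X k →ₗ[ℂ] Form X (k + 1 + 1)) from
      LinearMap.ext fun θ => Form.d_d θ, Conv.map_zero_left]
  have h2 : Conv.map R Form.d (Conv.bracket hR (Form.wedge (Nat.add_comm 1 k)) α s) =
      Conv.bracket hR (Form.wedge (Nat.add_comm 2 k)) (Conv.map R Form.d α) s +
        Conv.bracket hR (-Form.wedge (Nat.add_comm 1 (k + 1))) α (Conv.map R Form.d s) :=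
    Conv.map_bracket hR _ _ _ _ _ _ (fun a b => by
      rw [Form.d_wedge_one, sub_eq_add_neg]; rfl) α s
  have h4 := Conv.bracket_bracket_self hR (Form.wedge (X := X) (rfl : 1 + 1 = 2))
    (Form.wedge (Nat.add_comm 2 k)) (Form.wedge (Nat.add_comm 1 k))
    (Form.wedge (Nat.add_comm 1 (k + 1)))
    (fun a a' b => Form.wedge_assoc _ _ _ _ a a' b) Form.wedge_one_one α s
  rw [nabla_apply, nabla_apply, map_sub, map_sub, h1, h2, Conv.bracket_neg_coeff, h4, hα, map_smul,
    LinearMap.smul_apply]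
  abel

end Connection

/-! ### The transferred products in simplicial degree zero -/

section SimplexZero

namespace Simplex

theorem whitney_vertex (x : Fin 0 → ℝ) : whitney ({0} : Finset (Fin 1)) x = GAlt.one := by
  have h : ({0} : Finset (Fin 1)).sort (· ≤ ·) = [0] := Finset.sort_singleton _ _
  rw [whitney, h]
  simp [bary, GAlt.wedgeList]

/-- The transferred binary product of the unit on the point is the unit. -/
theorem coeff_zero_pair : coeff 0 [({0} : Finset (Fin 1)), {0}] = 1 := by
  have h1 : Finset.Ioo 0 2 = {1} := rfl
  have h2 : ∀ x, kernel 2 [({0} : Finset (Fin 1)), {0}] x 0 (fun i => Pi.single i 1) = 1 := by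
    intro x
    have : kernel 2 [({0} : Finset (Fin 1)), {0}] x = GAlt.one.wedge GAlt.one := by
      rw [kernel]
      simp [h1, wedge, whitney_vertex, faceDegree]
    rw [this]
    simp [GAlt.wedge, GAlt.one, wedgeCLM_apply]
  have h3 : coordSimplex 0 = univ := by
    ext x
    simp [coordSimplex]
  rw [coeff, h3]
  simp only [List.length_cons, List.length_nil, zero_add, Nat.reduceAdd, h2]
  simp [MeasureTheory.Measure.real, MeasureTheory.volume_pi]

end Simplex

variable {X : ComplexManifold.{u}}

theorem Form.wedge_one_right (a : Form X 1) : Form.wedge (Nat.add_zero 1) a (Form.one X) = a := by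
  refine Form.ext_apply fun x => ?_
  rw [Form.wedge_apply]
  ext v
  rw [wedgeCLM_apply]
  simp [Form.one]

theorem GForm.wedgeList_pair {a b : GForm X} (ha : ∀ q, q ≠ 1 → a q = 0)
    (hb : ∀ q, q ≠ 1 → b q = 0) :
    GForm.wedgeList [a, b] 2 = Form.wedge rfl (a 1) (b 1) := by
  have h1 : GForm.wedge b (GForm.one X) 1 = b 1 := by
    rw [GForm.wedge, Fin.sum_univ_two]
    simp only [Fin.val_zero, Fin.val_one, hb 0 zero_ne_one, map_zero, LinearMap.zero_apply,
      zero_add]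
    exact Form.wedge_one_right (b 1)
  rw [GForm.wedgeList, List.foldr_cons, List.foldr_cons, List.foldr_nil, GForm.wedge,
    Fin.sum_univ_three]
  simp only [Fin.val_zero, Fin.val_one, Fin.val_two, ha 0 zero_ne_one, ha 2 (by simp), map_zero,
    LinearMap.zero_apply, zero_add, add_zero]
  exact congrArg (Form.wedge rfl (a 1)) h1

variable {S : SimplicialManifold.{u}}

theorem BiForm.act_of_unique (f : Fin (0 + 1) →o Fin (0 + 1)) (a : GForm (S.obj 0)) :
    BiForm.act f a = a := by
  obtain rfl : f = OrderHom.id := by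
    ext x
    have h1 := (f x).2
    have h2 := x.2
    change ((f x : Fin (0 + 1)) : ℕ) = x
    omega
  funext q
  refine Subtype.ext ?_
  change pullPt (S.map OrderHom.id) (a q).1 = (a q).1
  rw [S.map_id 0, pullPt_id]

/-- The only face of the point. -/
def pointFace : {I : Finset (Fin (0 + 1)) // I.Nonempty} := ⟨{0}, Finset.singleton_nonempty 0⟩

theorem eq_pointFace (I : {I : Finset (Fin (0 + 1)) // I.Nonempty}) : I = pointFace := by
  have : Subsingleton (Fin (0 + 1)) := inferInstanceAs (Subsingleton (Fin 1))
  refine Subtype.ext ?_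
  obtain ⟨x, hx⟩ := I.2
  ext y
  obtain rfl : y = x := Subsingleton.elim y x
  exact iff_of_true hx (Finset.mem_singleton.2 (Subsingleton.elim y 0))

/-- In simplicial degree zero the products of arity greater than `2` vanish. -/
theorem BiForm.product_zero_of_ne {n : ℕ} (hn : n ≠ 2) (a : Fin n → BiForm S) :
    BiForm.product a 0 = 0 := by
  refine Finset.sum_eq_zero fun I hI => ?_
  have h := (Finset.mem_filter.1 hI).2
  have h2 : ∀ i, (I i).1.card - 1 = 0 := fun i => by rw [eq_pointFace (I i)]; rfl
  simp only [h2, Finset.sum_const_zero] at h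
  omega

/-- In simplicial degree zero the binary product is the wedge product of forms. -/
theorem BiForm.product_two (a : Fin 2 → BiForm S) :
    BiForm.product a 0 = GForm.wedgeList [a 0 0, a 1 0] := by
  have hI : ∀ I : Fin 2 → {I : Finset (Fin (0 + 1)) // I.Nonempty}, I = fun _ => pointFace :=
    fun I => funext fun i => eq_pointFace (I i)
  have hs : (Finset.univ : Finset (Fin 2 → {I : Finset (Fin (0 + 1)) // I.Nonempty})).filter
      (fun I => ∑ i, ((I i).1.card - 1) + 2 = 0 + 2) = {fun _ => pointFace} := by
    ext I
    rw [hI I]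
    simp [pointFace]
  have ht : ∀ (n : ℕ) (b : GForm (S.obj 0)), n = 0 → GForm.twist n b = b := by
    rintro n b rfl
    funext q
    simp [GForm.twist]
  have h2 : ∀ i : Fin 2, GForm.twist (∑ j ∈ Finset.Ioi i, (pointFace.1.card - 1))
      (BiForm.act (face pointFace) (a i (pointFace.1.card - 1))) = a i 0 := fun i =>
    (ht _ _ (Finset.sum_eq_zero fun _ _ => rfl)).trans (BiForm.act_of_unique _ (a i 0))
  rw [BiForm.product, hs, Finset.sum_singleton]
  simp only [h2]
  have h3 : List.ofFn (fun _ : Fin 2 => pointFace.1) = [({0} : Finset (Fin 1)), {0}] := rfl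
  have h4 : List.ofFn (fun i : Fin 2 => a i 0) = [a 0 0, a 1 0] := rfl
  rw [h3, h4, Simplex.coeff_zero_pair, one_smul]

end SimplexZero

/-! ### The Maurer–Cartan equation in bidegree `(0, 2)` -/

section MaurerCartan

variable {ι : Type*}

theorem splits_eq_map (w : List ι) :
    splits w = (List.range (w.length + 1)).map fun i => (w.take i, w.drop i) := by
  induction w with
  | nil => rfl
  | cons x w ih =>
    rw [splits, ih, List.length_cons, List.range_succ_eq_map (n := w.length + 1)]
    simp [List.map_map, Function.comp_def]

theorem conv_eq_sum {A B C : Type*} [AddCommGroup A] [AddCommGroup B] [AddCommGroup C]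
    [Module ℂ A] [Module ℂ B] [Module ℂ C] (β : A →ₗ[ℂ] B →ₗ[ℂ] C) {f : List ι → A}
    {g : List ι → B} (hf : f [] = 0) (hg : g [] = 0) (w : List ι) :
    conv β f g w = ∑ i ∈ Finset.Ioo 0 w.length, β (f (w.take i)) (g (w.drop i)) := by
  have h1 : conv β f g w =
      ∑ i ∈ Finset.range (w.length + 1), β (f (w.take i)) (g (w.drop i)) := by
    rw [conv, splits_eq_map, List.map_map]
    rfl
  rw [h1]
  symm
  refine Finset.sum_subset (fun i hi => ?_) fun i hi hi' => ?_
  · simp only [Finset.mem_Ioo, Finset.mem_range] at hi ⊢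
    omega
  · simp only [Finset.mem_Ioo, Finset.mem_range] at hi hi'
    rcases Nat.eq_zero_or_pos i with rfl | h0
    · simp [hf]
    · rw [List.drop_eq_nil_of_le (by omega), hg, map_zero]

theorem splitWrtComposition_of_length_one (w : List ι) {c : Composition w.length}
    (hc : c.length = 1) : w.splitWrtComposition c = [w] := by
  obtain ⟨a, ha⟩ := List.length_eq_one_iff.1 hc
  have h := c.blocks_sum
  rw [ha, List.sum_singleton] at h
  rw [List.splitWrtComposition, ha, h]
  simp [List.splitWrtCompositionAux]

theorem splitWrtComposition_of_length_two (w : List ι) {c : Composition w.length}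
    (hc : c.length = 2) : w.splitWrtComposition c =
      [w.take (c.blocks.headD 0), w.drop (c.blocks.headD 0)] := by
  obtain ⟨a, b, ha⟩ := List.length_eq_two.1 hc
  have h := c.blocks_sum
  rw [ha] at h
  simp only [List.sum_cons, List.sum_nil, add_zero] at h
  rw [List.splitWrtComposition, ha]
  simp [List.splitWrtCompositionAux, ← h]

/-- Compositions of length two are given by their first block. -/
theorem sum_composition_length_two {A : Type*} [AddCommMonoid A] (n : ℕ) (F : ℕ → A) :
    ∑ c ∈ (Finset.univ : Finset (Composition n)).filter (fun c => c.length = 2),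
      F (c.blocks.headD 0) = ∑ i ∈ Finset.Ioo 0 n, F i := by
  refine Finset.sum_nbij (fun c => c.blocks.headD 0) (fun c hc => ?_) (fun c hc c' hc' h => ?_)
    (fun i hi => ?_) fun _ _ => rfl
  · obtain ⟨a, b, ha⟩ := List.length_eq_two.1 (Finset.mem_filter.1 hc).2
    have h := c.blocks_sum
    have h1 := c.blocks_pos (i := a) (by simp [ha])
    have h2 := c.blocks_pos (i := b) (by simp [ha])
    rw [ha] at h ⊢
    simp only [List.sum_cons, List.sum_nil, add_zero, List.headD_cons, Finset.mem_Ioo] at h ⊢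
    omega
  · obtain ⟨a, b, ha⟩ := List.length_eq_two.1 (Finset.mem_filter.1 hc).2
    obtain ⟨a', b', ha'⟩ := List.length_eq_two.1 (Finset.mem_filter.1 hc').2
    have e := c.blocks_sum
    have e' := c'.blocks_sum
    refine Composition.ext ?_
    simp only [ha, ha', List.sum_cons, List.sum_nil, add_zero, List.headD_cons] at e e' h ⊢
    have : b = b' := by omega
    rw [h, this]
  · have hi' := Finset.mem_Ioo.1 (Finset.mem_coe.1 hi)
    refine ⟨⟨[i, n - i], fun {j} hj => ?_, ?_⟩, ?_, rfl⟩
    · simp only [List.mem_cons, List.not_mem_nil, or_false] at hj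
      omega
    · simp only [List.sum_cons, List.sum_nil, add_zero]
      omega
    · simp [Composition.length]

variable {S : SimplicialManifold.{u}}

theorem mcCurvature_eq_sum (f : List ι → BiForm S) (w : List ι) :
    mcCurvature f w = ∑ k ∈ Finset.Icc 1 w.length, convOp k (fun _ => f) w := by
  refine Finset.sum_congr rfl fun k _ => ?_
  have h : (k.factorial : ℂ) ≠ 0 := by exact_mod_cast k.factorial_ne_zero
  rw [convBracket, Finset.sum_const, Finset.card_univ, Fintype.card_perm, Fintype.card_fin,
    ← Nat.cast_smul_eq_nsmul ℂ, smul_smul, inv_mul_cancel₀ h, one_smul]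

/-- The component of bidegree `(0, 2)` of the Maurer–Cartan equation only involves the exterior
derivative and the wedge product on the manifold of simplicial degree zero. -/
theorem restrict_mcCurvature {f : List ι → BiForm S} (hf0 : f [] = 0)
    (hf : ∀ w p q, p + q ≠ 1 → f w p q = 0) (w : List ι) :
    restrict S 2 (mcCurvature f w) =
      conv (Form.wedge rfl) (fun v => restrict S 1 (f v)) (fun v => restrict S 1 (f v)) w -
        Form.d (restrict S 1 (f w)) := by
  have hop : ∀ k, restrict S 2 (convOp k (fun _ => f) w) =
      ∑ c ∈ (Finset.univ : Finset (Composition w.length)).filter (fun c => c.length = k),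
        (-1 : ℂ) ^ k • restrict S 2
          (BiForm.m k fun i => f ((w.splitWrtComposition c).getD i [])) := fun k => by
    simp only [convOp, map_sum, map_smul]
  have h1 : w ≠ [] → restrict S 2 (convOp 1 (fun _ => f) w) = -Form.d (restrict S 1 (f w)) := by
    intro hw
    have hs : (Finset.univ : Finset (Composition w.length)).filter (fun c => c.length = 1) =
        {Composition.single w.length (List.length_pos_iff.2 hw)} := by
      ext c
      simp [Composition.eq_single_iff_length]
    rw [hop, hs, Finset.sum_singleton,
      splitWrtComposition_of_length_one w (Composition.single_length _)]
    change (-1 : ℂ) ^ 1 • (0 + (-1 : ℂ) ^ 0 • Form.d (f w 0 1)) = -Form.d (f w 0 1)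
    simp
  have h2 : restrict S 2 (convOp 2 (fun _ => f) w) =
      conv (Form.wedge rfl) (fun v => restrict S 1 (f v)) (fun v => restrict S 1 (f v)) w := by
    have h0 : restrict S 1 (f []) = 0 := by rw [hf0, map_zero]
    rw [hop, conv_eq_sum _ h0 h0, ← sum_composition_length_two]
    refine Finset.sum_congr rfl fun c hc => ?_
    rw [splitWrtComposition_of_length_two w (Finset.mem_filter.1 hc).2]
    have h3 : ∀ a : Fin 2 → BiForm S, (∀ i q, q ≠ 1 → a i 0 q = 0) →
        restrict S 2 (BiForm.m 2 a) = Form.wedge rfl (a 0 0 1) (a 1 0 1) := fun a ha => by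
      rw [← GForm.wedgeList_pair (ha 0) (ha 1), ← BiForm.product_two]
      rfl
    rw [h3 _ fun i q hq => hf _ 0 q (by omega)]
    simp
    rfl
  have h3 : ∀ k, k ≠ 1 → k ≠ 2 → restrict S 2 (convOp k (fun _ => f) w) = 0 := by
    intro k hk1 hk2
    rw [hop]
    refine Finset.sum_eq_zero fun c _ => ?_
    rcases k with _ | _ | k
    · simp [BiForm.m]
    · exact absurd rfl hk1
    · have : restrict S 2 (BiForm.product fun i : Fin (k + 2) =>
          f ((w.splitWrtComposition c).getD i [])) = 0 :=
        congrFun (BiForm.product_zero_of_ne hk2 _) 2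
      exact (congrArg _ this).trans (smul_zero _)
  rw [mcCurvature_eq_sum, map_sum]
  rcases w with _ | ⟨x, w⟩
  · simp [conv_nil, hf0]
  · rw [sub_eq_neg_add, ← h1 (by simp), ← h2]
    -- On a letter the sum stops at `k = 1`, and the convolution vanishes.
    rcases w with _ | ⟨y, w⟩
    · have : restrict S 2 (convOp 2 (fun _ => f) [x]) = 0 := by
        rw [h2]
        simp [conv_cons, conv_nil, hf0]
      rw [this, add_zero]
      simp
    · rw [← Finset.sum_pair (f := fun k => restrict S 2 (convOp k (fun _ => f) (x :: y :: w)))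
        (by simp : (1 : ℕ) ≠ 2)]
      symm
      refine Finset.sum_subset (fun k hk => ?_) fun k _ hk => ?_
      · simp only [Finset.mem_insert, Finset.mem_singleton, List.length_cons,
          Finset.mem_Icc] at hk ⊢
        omega
      · simp only [Finset.mem_insert, Finset.mem_singleton, not_or] at hk
        exact h3 k hk.1 hk.2

/-- The Maurer–Cartan equation implies that the connection form satisfies the structure
equation `d α = ½ [α, α]`. -/
theorem d_restrictConn [Finite ι] (B : CInfSubalgebra S) {R : LieIdeal ℂ (Lhat ι)}
    (hR : IsClosedIdeal R) {c : Conv R (B.part 1)} (hc : IsMaurerCartan B c) :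
    Conv.map R Form.d (restrictConn B R c) = (1 / 2 : ℂ) •
      Conv.bracket hR (Form.wedge rfl) (restrictConn B R c) (restrictConn B R c) := by
  obtain ⟨f, rfl, hf⟩ := hc
  rw [restrictConn, Conv.map_mk, Conv.map_mk, Conv.bracket_mk, ← Submodule.Quotient.mk_smul,
    ← sub_eq_zero, ← Submodule.Quotient.mk_sub, Submodule.Quotient.mk_eq_zero]
  intro φ
  obtain ⟨g, hg, hg'⟩ := hf (φ ∘ₗ restrict S 2)
  -- The curvature is `-d α + ½ [α, α]` in bidegree `(0, 2)`.
  refine ⟨-g, neg_mem hg, funext fun w => ?_⟩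
  have e : (-g).1 w = -g.1 w := rfl
  have hr := restrict_mcCurvature (f := fun w => (f.1 w : BiForm S)) (by rw [f.2.1]; rfl)
    (fun w => (B.part_le 1 (f.1 w).2).1) w
  have hg'' : g.1 w = φ (restrict S 2 (mcCurvature (fun w => (f.1 w : BiForm S)) w)) :=
    congrFun hg' w
  rw [e, hg'', hr, ← map_neg, neg_sub]
  congr 1
  set a : List ι → Form (S.obj 0) 1 := fun v => restrict S 1 (f.1 v : BiForm S) with ha
  change _ = Form.d (a w) - (1 / 2 : ℂ) • brFun (Form.wedge rfl) a a w
  rw [brFun_self _ Form.wedge_one_one, Pi.smul_apply, smul_smul,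
    show (1 / 2 : ℂ) * 2 = 1 by norm_num, one_smul]

end MaurerCartan

end GeomConn

end

theorem mainTheorem4 (S : SimplicialManifold.{u}) (B : CInfSubalgebra S)
    {W1 W2 : Type*} [AddCommGroup W1] [Module ℂ W1] [AddCommGroup W2] [Module ℂ W2]
    [FiniteDimensional ℂ W2] (W : MinimalOneCInf W1 W2)
    {ι : Type*} [Fintype ι] (b : Module.Basis ι ℂ W1)
    (c : Conv (W.relIdeal b) (B.part 1)) (hc : IsMaurerCartan B c) :
    let α : Conv (W.relIdeal b) (Form (S.obj 0) 1) := restrictConn B (W.relIdeal b) c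
    let D := nabla (W.isClosedIdeal_relIdeal b) α
    IsPronilpotent (W.Fibre b) ∧
    (∀ (f : Form (S.obj 0) 0) (s : Conv (W.relIdeal b) (Form (S.obj 0) 0)),
      D 0 (Conv.map (W.relIdeal b) (Form.wedge (Nat.zero_add 0) f) s) =
        Conv.map (W.relIdeal b) (Form.wedge (Nat.add_zero 1) (Form.d f)) s +
          Conv.map (W.relIdeal b) (Form.wedge (Nat.zero_add 1) f) (D 0 s)) ∧
    (∀ (k : ℕ) (s : Conv (W.relIdeal b) (Form (S.obj 0) k)), D (k + 1) (D k s) = 0) ∧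
    Conv.map (W.relIdeal b) Form.d α =
      (1 / 2 : ℂ) • Conv.bracket (W.isClosedIdeal_relIdeal b) (Form.wedge rfl) α α ∧
    (IsHolElement B c → IsHolConn α) ∧
    (∀ L : LogPair S, IsHolLogElement B L c → IsHolLogConn (L.divisor 0) (L.incl 0) α) := by
  intro α D
  have hR := W.isClosedIdeal_relIdeal b
  have hα := d_restrictConn B hR hc
  refine ⟨isPronilpotent_quotient hR, fun f s => nabla_smul hR α f s,
    fun k s => nabla_nabla hR hα s, hα, ?_, fun L => ?_⟩
  · rintro ⟨f, rfl, hf⟩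
    exact ⟨LieFun.map ((restrict S 1).comp (B.part 1).subtype) f, rfl, fun w => hf w 0 1⟩
  · rintro ⟨f, rfl, hf⟩
    exact ⟨LieFun.map ((restrict S 1).comp (B.part 1).subtype) f, rfl, fun w => hf w 0 1⟩
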